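/- Let $0<\alpha<\pi/2$, $\beta=\pi-\alpha$, and let $P$ be a right-angle trapezoid with consecutive vertices $\mathbf a,\mathbf b,\mathbf c,\mathbf d$ and angles $\alpha,\beta,\pi/2,\pi/2$ at them; the side $[\mathbf a,\mathbf b]$ is its hypotenuse. Let $\Omega\subset\mathbb R^2=\mathbb C$ be a (nondegenerate) square and let $\Omega=\bigcup_{j=1}^N P_j$ be a tiling, where $P_j=\phi_j(P)$ with isometries $\phi_j$ of the plane (reflections allowed) and the interiors of the $P_j$ are pairwise disjoint. The hypotenuse graph $(V,\Gamma)$ is the directed graph with vertex set $V=\bigcup_j\{\phi_j(\mathbf a),\phi_j(\mathbf b)\}$ and exactly one edge for each $j$, from $\phi_j(\mathbf a)$ to $\phi_j(\mathbf b)$ (parallel edges are allowed). Assume that every connected component of this graph (as an undirected graph) is Eulerian, that is, has a closed directed trail containing all of its edges. Let $V_1$ be the set of the $u\in V$ around which the angles of the tiles with vertex $u$, listed clockwise, are $(\alpha,\alpha,\beta,\beta)$ up to a rotation; write $L_{u,\alpha},R_{u,\alpha},R_{u,\beta},L_{u,\beta}$ for the corresponding tiles. At such $u$, pair the incoming hypotenuse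 of $L_{u,\beta}$ with the outgoing hypotenuse of $L_{u,\alpha}$, and the incoming hypotenuse of $R_{u,\beta}$ with the outgoing one of $R_{u,\alpha}$. A feasible cycle is a closed directed trail $\gamma_1+\dots+\gamma_m$ in $(V,\Gamma)$ ($m\ge1$, distinct edges) in which each edge entering a vertex $u\in V_1$ is followed by the edge paired with it at $u$, and which passes through no vertex of $V\setminus V_1$ twice. Then: 1. $N$ is even. 2. $\Gamma$ is the union of edge-disjoint feasible cycles. 3. If $\gamma_1+\dots+\gamma_m$ is a feasible cycle, then $m$ is even. Moreover, with $\omega=e^{i\alpha}$, there is $z\in\mathbb C$ with $|z|=1$ such that every unit edge vector $v_k=\vec\gamma_k/|\vec\gamma_k|$ lies in $z\cdot\{\pm1,\pm i,\pm\omega,\pm i\omega\}$; and with $n(w)=\#\{k: v_k=w\}-\#\{k: v_k=-w\}$ and $a=n(z)$, $b=n(zi)$, $c=n(z\omega)$, $d=n(zi\omega)$, one has $a^2+b^2=c^2+d^2$, and $a+b+c+d$ is even. -/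

import Mathlib

noncomputable section

namespace TrapezoidTiling

/-! ### Directed graphs with possibly multiple edges -/

/-- A directed graph; the type `E` is its edge set, so parallel edges are allowed. -/
structure DirGraph (V E : Type*) where
  vertexSet : Set V
  origin : E → V
  terminus : E → V
  origin_mem : ∀ e, origin e ∈ vertexSet
  terminus_mem : ∀ e, terminus e ∈ vertexSet

namespace DirGraph

variable {V E : Type*} (G : DirGraph V E)

/-- `u` and `v` lie in the same connected component: some path joins them in the underlying
undirected graph. -/
def Joined (u v : V) : Prop :=
  Relation.EqvGen (fun x y => ∃ e, G.origin e = x ∧ G.terminus e = y) u v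

/-- A closed directed trail `γ 0, γ 1, …, γ (m - 1)`, given by its pairwise distinct edges.
The indices are cyclic: `finRotate m i` is the index after `i`, and `0` comes after `m - 1`. -/
structure IsClosedTrail {m : ℕ} (γ : Fin m → E) : Prop where
  injective : Function.Injective γ
  consecutive : ∀ i, G.terminus (γ i) = G.origin (γ (finRotate m i))

/-- Every connected component is Eulerian: it has a closed trail containing all of its edges. -/
def ComponentwiseEulerian : Prop :=
  ∀ v ∈ G.vertexSet, ∃ (m : ℕ) (γ : Fin m → E), G.IsClosedTrail γ ∧
    Set.range γ = {e | G.Joined v (G.origin e)}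

end DirGraph

/-! ### Tilings of a square by congruent right-angle trapezoids -/

/-- The closed square with vertices `q`, `q + s`, `q + s + i s`, `q + i s`; every
(nondegenerate) square of the plane has this form with `s ≠ 0`. -/
def squareRegion (q s : ℂ) : Set ℂ :=
  convexHull ℝ {q, q + s, q + s + Complex.I * s, q + Complex.I * s}

/-- The angle at vertex `i` of the quadrilateral with consecutive vertices `p 0, …, p 3`
(the indices are taken modulo 4). -/
def vertexAngle (p : Fin 4 → ℂ) (i : Fin 4) : ℝ :=
  EuclideanGeometry.angle (p (i - 1)) (p i) (p (i + 1))

/-- `p 0, p 1, p 2, p 3` are the consecutive vertices `a, b, c, d` of a right-angle trapezoid,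
with angles `α`, `π - α`, `π / 2`, `π / 2`, where `0 < α < π / 2`; its hypotenuse is `[a, b]`.
The four angle conditions force the points to be distinct and in convex position. -/
structure IsRightTrapezoid (α : ℝ) (p : Fin 4 → ℂ) : Prop where
  pos : 0 < α
  lt : α < Real.pi / 2
  angle_a : vertexAngle p 0 = α
  angle_b : vertexAngle p 1 = Real.pi - α
  angle_c : vertexAngle p 2 = Real.pi / 2
  angle_d : vertexAngle p 3 = Real.pi / 2

/-- The region bounded by a convex quadrilateral. -/
def region (p : Fin 4 → ℂ) : Set ℂ := convexHull ℝ (Set.range p)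

/-- The tiles `φ j (P)`, congruent to `P`, form a tiling of `Ω`. -/
structure IsTiling (Ω P : Set ℂ) {N : ℕ} (φ : Fin N → ℂ ≃ᵢ ℂ) : Prop where
  cover : Ω = ⋃ j, φ j '' P
  interiors_disjoint :
    Pairwise fun j k => Disjoint (interior (φ j '' P)) (interior (φ k '' P))

section HypotenuseGraph

variable (p : Fin 4 → ℂ) {N : ℕ} (φ : Fin N → ℂ ≃ᵢ ℂ)

/-- The hypotenuse graph: the tile with index `j` contributes one directed edge, from `φ j a`
to `φ j b`. -/
def hypotenuseGraph : DirGraph ℂ (Fin N) where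
  vertexSet := ⋃ j, {φ j (p 0), φ j (p 1)}
  origin j := φ j (p 0)
  terminus j := φ j (p 1)
  origin_mem j := Set.mem_iUnion.2 ⟨j, Or.inl rfl⟩
  terminus_mem j := Set.mem_iUnion.2 ⟨j, Or.inr rfl⟩

/-- The points `z 0, z 1, …` are met in this order when one turns clockwise around `u`, within
less than a full turn. -/
def IsClockwiseAround (u : ℂ) {k : ℕ} (z : Fin k → ℂ) : Prop :=
  ∃ t : Fin k → ℝ, StrictAnti t ∧ (∀ i j, t i - t j < 2 * Real.pi) ∧
    ∀ i, z i ≠ u ∧ z i - u = (‖z i - u‖ : ℂ) * Complex.exp ((t i : ℂ) * Complex.I)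

/-- The point of the tile `j` corresponding to the mean of the four vertices. It lies in the
interior of the tile; the direction from a vertex of the tile to it lies inside the angle of the
tile at that vertex, and thus serves to order the angles around that vertex. -/
def tileCenter (j : Fin N) : ℂ := φ j ((p 0 + p 1 + p 2 + p 3) / 4)

/-- The pairs `x n = (j, i)` list, without repetition and in clockwise order, all tiles `j` with a
vertex `φ j (p i)` at `u`, and the angles of these tiles at `u` are `θ 0, θ 1, …`. So `θ` is the
angle pattern at `u`. The order may start at any of the tiles, so that the pattern is determined
only up to a rotation. -/
structure IsAnglePattern (u : ℂ) {k : ℕ} (x : Fin k → Fin N × Fin 4) (θ : Fin k → ℝ) :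
    Prop where
  injective : Function.Injective x
  range_eq : Set.range x = {c | φ c.1 (p c.2) = u}
  clockwise : IsClockwiseAround u fun n => tileCenter p φ (x n).1
  angle_eq : ∀ n, vertexAngle (fun i => φ (x n).1 (p i)) (x n).2 = θ n

/-- The vertices (`V₁`) whose angle pattern is `(α, α, β, β)` up to a rotation, `β = π - α`. -/
def aabbVertices (α : ℝ) : Set ℂ :=
  {u | u ∈ (hypotenuseGraph p φ).vertexSet ∧ ∃ x : Fin 4 → Fin N × Fin 4,
    IsAnglePattern p φ u x ![α, α, Real.pi - α, Real.pi - α]}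

/-- The pairing of hypotenuses at a vertex `u` with angle pattern `(α, α, β, β)`. If `L_α, R_α,
R_β, L_β` are the tiles around `u` in this clockwise order, then the incoming hypotenuse of `L_β`
is joined with the outgoing hypotenuse of `L_α`, and that of `R_β` with that of `R_α`. Here `e` is
the incoming and `f` the outgoing edge. -/
def Paired (α : ℝ) (u : ℂ) (e f : Fin N) : Prop :=
  ∃ x : Fin 4 → Fin N × Fin 4,
    IsAnglePattern p φ u x ![α, α, Real.pi - α, Real.pi - α] ∧
      ((e = (x 3).1 ∧ f = (x 0).1) ∨ (e = (x 2).1 ∧ f = (x 1).1))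

/-- Feasible cycles: the cycles of the graph obtained from the hypotenuse graph by merging, at
every vertex `u` of `V₁`, each pair of paired edges into one edge, so that `u` is no longer a
vertex. As sequences of edges of the hypotenuse graph they are the nonempty closed trails which
follow the pairing at the vertices of `V₁` and pass through no other vertex twice. -/
structure IsFeasibleCycle (α : ℝ) {m : ℕ} (γ : Fin m → Fin N) : Prop where
  nonempty : 0 < m
  closedTrail : (hypotenuseGraph p φ).IsClosedTrail γ
  paired : ∀ i, (hypotenuseGraph p φ).terminus (γ i) ∈ aabbVertices p φ α →
    Paired p φ α ((hypotenuseGraph p φ).terminus (γ i)) (γ i) (γ (finRotate m i))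
  simple : ∀ i i', (hypotenuseGraph p φ).terminus (γ i) ∉ aabbVertices p φ α →
    (hypotenuseGraph p φ).terminus (γ i) = (hypotenuseGraph p φ).terminus (γ i') → i = i'

/-- The edge `j` as a vector, scaled by the common length of all hypotenuses to a unit vector. -/
def unitEdgeVector (j : Fin N) : ℂ :=
  ((hypotenuseGraph p φ).terminus j - (hypotenuseGraph p φ).origin j) / (dist (p 0) (p 1) : ℂ)

/-- The number of edges of `γ` with unit vector `w`, minus the number of those with unit
vector `-w`. -/
def signedCount {m : ℕ} (γ : Fin m → Fin N) (w : ℂ) : ℤ :=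
  (Nat.card {i // unitEdgeVector p φ (γ i) = w} : ℤ) -
    (Nat.card {i // unitEdgeVector p φ (γ i) = -w} : ℤ)

end HypotenuseGraph

end TrapezoidTiling

end

noncomputable section

namespace TrapezoidTiling

open Complex ComplexConjugate Filter Topology MeasureTheory

/-! The heart of the matter is an invariant of tiles that is constant along feasible cycles. To each
tile is attached the unit direction `X` of the clockwise side of its angle `α`; its unit hypotenuse
is `X` or `X * ω`, depending on orientation. The invariant is `X ^ 4`, the direction up to quarter
turns.

Local relations come from the integrals of `(z - u) ^ 4` over small discs centered at `u`. An angle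
of opening `L` with clockwise side `X` contributes a nonzero multiple of `X ^ 4 * (exp (L * I) ^ 4 -
1)`. Angles `π / 2`, `π` and `2π` thus contribute nothing, whether they belong to tiles or to the
square. An angle `α` and an angle `π - α` contribute opposite multiples of the invariants of their
tiles. Hence the invariants of the tiles leaving `u` and of those entering `u` have the same sum
(`FramedTiling.sum_pow_four`).

The Eulerian hypothesis makes the in-degree and the out-degree equal at every vertex, say to `k`.
The hypotenuse angles at a vertex add up to `kπ`, which is at most `2π`. If `k = 1`, the relation
above says that the two invariants agree. If `k = 2`, four angles fill the full turn: either `α` and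
`π - α` alternate and all invariants agree (`FramedTiling.pow_four_eq_of_notMem`), or the pattern is
that of `aabbVertices` and paired edges have equal invariants
(`FramedTiling.pow_four_eq_of_paired`).

So the unit vectors of a feasible cycle lie in `z * {±1, ±i, ±ω, ±iω}`. They sum to zero, so `a + b
i = -(c + d i) ω`. Taking norms gives `a² + b² = c² + d²`, whence `a + b + c + d` is even; it has
the parity of the length (`counts_of_sum_eq_zero`). Joining incoming to outgoing edges at each
vertex gives a permutation of the edges whose cycles, after enough splitting, are feasible
(`exists_perm_simple`). Their even lengths add up to `N`. -/

/-- The closed angular region of opening `L ≤ π` whose clockwise side points to `X`. -/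
def cone (X : ℂ) (L : ℝ) : Set ℂ :=
  {w | 0 ≤ (conj X * w).im ∧ (conj X * w).im * Real.cos L ≤ (conj X * w).re * Real.sin L}

/-- The interior of `cone X L`. -/
def openCone (X : ℂ) (L : ℝ) : Set ℂ :=
  {w | 0 < (conj X * w).im ∧ (conj X * w).im * Real.cos L < (conj X * w).re * Real.sin L}

/-- Near `u`, the set `T` coincides with the translate of `C` by `u`. -/
def HasGerm (T : Set ℂ) (u : ℂ) (C : Set ℂ) : Prop := ∀ᶠ z in 𝓝 u, z ∈ T ↔ z - u ∈ C

/-- Near `u`, the set `T` is empty, a half-plane or everything. -/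
def FlatGerm (T : Set ℂ) (u : ℂ) : Prop :=
  HasGerm T u ∅ ∨ (∃ X : ℂ, ‖X‖ = 1 ∧ HasGerm T u (cone X Real.pi)) ∨ HasGerm T u Set.univ

/-! ### The trapezoid in standard position and its germs -/

/-- A right trapezoid in standard position: `ℓ` is the length of its hypotenuse and `B` that of its
shorter base. -/
def stdVertex (α ℓ B : ℝ) : Fin 4 → ℂ :=
  ![0, ⟨ℓ * Real.cos α, ℓ * Real.sin α⟩, ⟨ℓ * Real.cos α + B, ℓ * Real.sin α⟩,
    ⟨ℓ * Real.cos α + B, 0⟩]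

section Std

variable {α ℓ B : ℝ}

/-- A point satisfying the inequalities lies on a horizontal segment joining points of the two sides
that connect the bases. Describing the region by inequalities lets its germs be read off from those
that are tight. -/
lemma region_stdVertex (h0 : 0 < α) (h1 : α < Real.pi / 2) (hℓ : 0 < ℓ) (hB : 0 < B) :
    region (stdVertex α ℓ B) = {z | 0 ≤ z.im ∧ z.im ≤ ℓ * Real.sin α ∧
      z.re ≤ ℓ * Real.cos α + B ∧ z.im * Real.cos α ≤ z.re * Real.sin α} := by
  have hs : 0 < Real.sin α := Real.sin_pos_of_pos_of_lt_pi h0 (by linarith [Real.pi_pos])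
  have hc : 0 < Real.cos α := Real.cos_pos_of_mem_Ioo ⟨by linarith, h1⟩
  apply Set.Subset.antisymm
  · apply convexHull_min
    · rintro _ ⟨i, rfl⟩
      fin_cases i <;> simp [stdVertex] <;> constructorm* _ ∧ _ <;>
        nlinarith [mul_pos hℓ hs, mul_pos hℓ hc, mul_pos hB hs]
    · intro x hx y hy a b ha hb hab
      simp only [Set.mem_ofPred_eq, add_im, add_re, real_smul, mul_im, mul_re, ofReal_re,
        ofReal_im, zero_mul, sub_zero, add_zero] at hx hy ⊢
      obtain rfl : b = 1 - a := by linarith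
      obtain ⟨x1, x2, x3, x4⟩ := hx
      obtain ⟨y1, y2, y3, y4⟩ := hy
      refine ⟨by positivity, ?_, ?_, ?_⟩
      · nlinarith [mul_le_mul_of_nonneg_left x2 ha, mul_le_mul_of_nonneg_left y2 hb]
      · nlinarith [mul_le_mul_of_nonneg_left x3 ha, mul_le_mul_of_nonneg_left y3 hb]
      · nlinarith [mul_le_mul_of_nonneg_left x4 ha, mul_le_mul_of_nonneg_left y4 hb]
  · rintro z ⟨z1, z2, z3, z4⟩
    have hK : Convex ℝ (region (stdVertex α ℓ B)) := convex_convexHull _ _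
    have hq : ∀ i, stdVertex α ℓ B i ∈ region (stdVertex α ℓ B) :=
      fun i => subset_convexHull _ _ ⟨i, rfl⟩
    have hh : 0 < ℓ * Real.sin α := by positivity
    set t := z.im / (ℓ * Real.sin α) with ht
    have ht0 : 0 ≤ t := by positivity
    have ht1 : t ≤ 1 := by rw [ht, div_le_one hh]; exact z2
    have hzt : z.im = t * (ℓ * Real.sin α) := by rw [ht]; field_simp
    have hA := hK (hq 0) (hq 1) (a := 1 - t) (b := t) (by linarith) ht0 (by ring)
    have hD := hK (hq 3) (hq 2) (a := 1 - t) (b := t) (by linarith) ht0 (by ring)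
    have hlo : t * (ℓ * Real.cos α) ≤ z.re := by
      rw [hzt] at z4
      have : (t * (ℓ * Real.cos α)) * Real.sin α ≤ z.re * Real.sin α := by linarith
      exact le_of_mul_le_mul_right this hs
    have hlt : 0 < ℓ * Real.cos α + B - t * (ℓ * Real.cos α) := by
      nlinarith [mul_pos hℓ hc]
    set s := (z.re - t * (ℓ * Real.cos α)) / (ℓ * Real.cos α + B - t * (ℓ * Real.cos α)) with hs'
    have hs0 : 0 ≤ s := div_nonneg (by linarith) hlt.le
    have hs1 : s ≤ 1 := by rw [hs', div_le_one hlt]; linarith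
    have hzs : z.re - t * (ℓ * Real.cos α) = s * (ℓ * Real.cos α + B - t * (ℓ * Real.cos α)) := by
      rw [hs', div_mul_cancel₀ _ hlt.ne']
    have hZ := hK hA hD (a := 1 - s) (b := s) (by linarith) hs0 (by ring)
    convert hZ using 1
    apply Complex.ext
    · simp [stdVertex]; linear_combination hzs
    · simp [stdVertex]; linear_combination hzt

/-- A closed set has an empty germ at the points outside it. -/
lemma hasGerm_empty {T : Set ℂ} (hT : IsClosed T) {u : ℂ} (hu : u ∉ T) : HasGerm T u ∅ := by
  filter_upwards [hT.isOpen_compl.mem_nhds hu] with z hz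
  simpa using hz

lemma stdVertex_germ (h0 : 0 < α) (h1 : α < Real.pi / 2) (hℓ : 0 < ℓ) (hB : 0 < B) (u : ℂ) :
    (u = stdVertex α ℓ B 0 ∧ HasGerm (region (stdVertex α ℓ B)) u (cone 1 α)) ∨
    (u = stdVertex α ℓ B 1 ∧
      HasGerm (region (stdVertex α ℓ B)) u (cone (-⟨Real.cos α, Real.sin α⟩) (Real.pi - α))) ∨
    ((u = stdVertex α ℓ B 2 ∨ u = stdVertex α ℓ B 3) ∧ ∃ X : ℂ, ‖X‖ = 1 ∧
      HasGerm (region (stdVertex α ℓ B)) u (cone X (Real.pi / 2))) ∨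
    ((∀ i, u ≠ stdVertex α ℓ B i) ∧ FlatGerm (region (stdVertex α ℓ B)) u) := by
  have hs : 0 < Real.sin α := Real.sin_pos_of_pos_of_lt_pi h0 (by linarith [Real.pi_pos])
  have hc : 0 < Real.cos α := Real.cos_pos_of_mem_Ioo ⟨by linarith, h1⟩
  have hsc : Real.sin α * Real.sin α + Real.cos α * Real.cos α = 1 := by
    nlinarith [Real.sin_sq_add_cos_sq α]
  have hlc := mul_pos hℓ hc
  have hls := mul_pos hℓ hs
  have hBs := mul_pos hB hs
  have hcl : IsClosed (region (stdVertex α ℓ B)) :=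
    ((Set.finite_range _).isCompact_convexHull ℝ).isClosed
  by_cases hu : u ∈ region (stdVertex α ℓ B)
  swap
  · refine Or.inr (Or.inr (Or.inr ⟨fun i hi => hu ?_, Or.inl (hasGerm_empty hcl hu)⟩))
    rw [hi]; exact subset_convexHull _ _ ⟨i, rfl⟩
  have hω : ‖(⟨Real.cos α, Real.sin α⟩ : ℂ)‖ = 1 := by
    rw [Complex.norm_eq_sqrt_sq_add_sq, add_comm, Real.sin_sq_add_cos_sq, Real.sqrt_one]
  rw [region_stdVertex h0 h1 hℓ hB] at hu ⊢
  obtain ⟨u1, u2, u3, u4⟩ := hu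
  have e1 : 0 < u.im → ∀ᶠ z in 𝓝 u, 0 < z.im := fun h =>
    continuous_im.continuousAt.eventually (lt_mem_nhds h)
  have e2 : u.im < ℓ * Real.sin α → ∀ᶠ z in 𝓝 u, z.im < ℓ * Real.sin α := fun h =>
    continuous_im.continuousAt.eventually (gt_mem_nhds h)
  have e3 : u.re < ℓ * Real.cos α + B → ∀ᶠ z in 𝓝 u, z.re < ℓ * Real.cos α + B := fun h =>
    continuous_re.continuousAt.eventually (gt_mem_nhds h)
  have e4 : u.im * Real.cos α < u.re * Real.sin α →
      ∀ᶠ z in 𝓝 u, z.im * Real.cos α < z.re * Real.sin α := fun h =>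
    (continuous_im.mul continuous_const).continuousAt.eventually_lt
      (continuous_re.mul continuous_const).continuousAt h
  -- Strict inequalities persist near `u` and drop out of the germ. No tight inequality gives the
  -- whole plane, one gives a half-plane, and two give a vertex; the remaining combinations are
  -- impossible.
  rcases u1.eq_or_lt with a1 | a1 <;> rcases u2.eq_or_lt with a2 | a2 <;>
    rcases u3.eq_or_lt with a3 | a3 <;> rcases u4.eq_or_lt with a4 | a4
  · exfalso; linarith
  · exfalso; linarith
  · exfalso; linarith
  · exfalso; linarith
  · exfalso; rw [← a1, a3] at a4; nlinarith
  · refine Or.inr (Or.inr (Or.inl ⟨Or.inr ?_, I, by simp, ?_⟩))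
    · apply Complex.ext <;> simp [stdVertex, a3, ← a1]
    · filter_upwards [e2 a2, e4 a4] with z z2 z4
      simp [cone, z2.le, z4.le, ← a1, a3, and_comm]
  · refine Or.inl ⟨?_, ?_⟩
    · rw [← a1] at a4
      have : u.re = 0 := by
        rcases mul_eq_zero.1 (by linarith : u.re * Real.sin α = 0) with h | h
        · exact h
        · exact absurd h hs.ne'
      apply Complex.ext <;> simp [stdVertex, this, ← a1]
    · have : u.re = 0 := by
        rw [← a1] at a4
        rcases mul_eq_zero.1 (by linarith : u.re * Real.sin α = 0) with h | h
        · exact h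
        · exact absurd h hs.ne'
      filter_upwards [e2 a2, e3 a3] with z z2 z3
      simp [cone, z2.le, z3.le, ← a1, this]
  · refine Or.inr (Or.inr (Or.inr ⟨?_, Or.inr (Or.inl ⟨1, by simp, ?_⟩)⟩))
    · intro i hi
      rw [hi] at a1 a2 a3 a4
      fin_cases i <;> simp [stdVertex] at a1 a2 a3 a4
    · filter_upwards [e2 a2, e3 a3, e4 a4] with z z2 z3 z4
      simp [cone, z2.le, z3.le, z4.le, ← a1]
  · exfalso; rw [a2, a3] at a4; nlinarith
  · refine Or.inr (Or.inr (Or.inl ⟨Or.inl ?_, -1, by simp, ?_⟩))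
    · apply Complex.ext <;> simp [stdVertex, a3, a2]
    · filter_upwards [e1 a1, e4 a4] with z z1 z4
      simp [cone, z1.le, z4.le, a2, a3, and_comm]
  · have : u.re = ℓ * Real.cos α := by
      rw [a2] at a4
      have : u.re * Real.sin α = ℓ * Real.cos α * Real.sin α := by linarith
      exact mul_right_cancel₀ hs.ne' this
    refine Or.inr (Or.inl ⟨?_, ?_⟩)
    · apply Complex.ext <;> simp [stdVertex, this, a2]
    · filter_upwards [e1 a1, e3 a3] with z z1 z3
      simp only [cone, z1.le, z3.le, a2, this, Set.mem_ofPred_eq, true_and, map_neg,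
        mul_im, mul_re, conj_re, conj_im, neg_re, neg_im, sub_re, sub_im, Real.cos_pi_sub,
        Real.sin_pi_sub]
      constructor
      · rintro ⟨h2, h4⟩
        constructor
        · nlinarith
        · nlinarith
      · rintro ⟨h2, h4⟩
        constructor
        · nlinarith
        · nlinarith
  · refine Or.inr (Or.inr (Or.inr ⟨?_, Or.inr (Or.inl ⟨-1, by simp, ?_⟩)⟩))
    · intro i hi
      rw [hi] at a1 a2 a3 a4
      fin_cases i <;> simp [stdVertex] at a1 a2 a3 a4 <;> linarith
    · filter_upwards [e1 a1, e3 a3, e4 a4] with z z1 z3 z4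
      simp [cone, z1.le, z3.le, z4.le, a2]
  · exfalso; rw [a3] at a4; nlinarith
  · refine Or.inr (Or.inr (Or.inr ⟨?_, Or.inr (Or.inl ⟨I, by simp, ?_⟩)⟩))
    · intro i hi
      rw [hi] at a1 a2 a3 a4
      fin_cases i <;> simp [stdVertex] at a1 a2 a3 a4
    · filter_upwards [e1 a1, e2 a2, e4 a4] with z z1 z2 z4
      simp [cone, z1.le, z2.le, z4.le, a3]
  · refine Or.inr (Or.inr (Or.inr ⟨?_, Or.inr (Or.inl ⟨-⟨Real.cos α, Real.sin α⟩, by rw [norm_neg, hω], ?_⟩)⟩))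
    · intro i hi
      rw [hi] at a1 a2 a3 a4
      fin_cases i <;> simp [stdVertex] at a1 a2 a3 a4
    · filter_upwards [e1 a1, e2 a2, e3 a3] with z z1 z2 z3
      simp only [cone, z1.le, z2.le, z3.le, Set.mem_ofPred_eq, true_and, map_neg,
        mul_im, mul_re, conj_re, conj_im, neg_re, neg_im, sub_re, sub_im, Real.cos_pi,
        Real.sin_pi]
      constructor
      · intro h; constructor <;> nlinarith
      · rintro ⟨h2, h4⟩; nlinarith
  · refine Or.inr (Or.inr (Or.inr ⟨?_, Or.inr (Or.inr ?_)⟩))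
    · intro i hi
      rw [hi] at a1 a2 a3 a4
      fin_cases i <;> simp [stdVertex] at a1 a2 a3 a4
    · filter_upwards [e1 a1, e2 a2, e3 a3, e4 a4] with z z1 z2 z3 z4
      simp [z1.le, z2.le, z3.le, z4.le]

end Std

/-! ### Plane isometries, and coordinates recovered from the angles -/

lemma isometry_form (f : ℂ ≃ᵢ ℂ) : ∃ w ζ : ℂ, ‖ζ‖ = 1 ∧
    ((∀ z, f z = w + ζ * z) ∨ ∀ z, f z = w + ζ * conj z) := by
  set g := f.toRealAffineIsometryEquiv with hg
  have hgf : ∀ z, f z = g.linearIsometryEquiv z + f 0 := by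
    intro z
    have := g.map_vadd 0 z
    simpa [hg] using this
  obtain ⟨a, ha | ha⟩ := linear_isometry_complex g.linearIsometryEquiv
  · refine ⟨f 0, a, Circle.norm_coe a, Or.inl fun z => ?_⟩
    rw [hgf z, ha, rotation_apply, add_comm]
  · refine ⟨f 0, a, Circle.norm_coe a, Or.inr fun z => ?_⟩
    rw [hgf z, ha, LinearIsometryEquiv.trans_apply, rotation_apply, conjLIE_apply, add_comm]

lemma exists_isometry (w ζ : ℂ) (hζ : ‖ζ‖ = 1) :
    (∃ ψ : ℂ ≃ᵢ ℂ, ∀ z, ψ z = w + ζ * z) ∧ ∃ ψ : ℂ ≃ᵢ ℂ, ∀ z, ψ z = w + ζ * conj z := by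
  let a : Circle := ⟨ζ, by simp [Submonoid.unitSphere, hζ]⟩
  refine ⟨⟨(rotation a).toIsometryEquiv.trans (IsometryEquiv.addLeft w), fun z => ?_⟩,
    ⟨(conjLIE.trans (rotation a)).toIsometryEquiv.trans (IsometryEquiv.addLeft w), fun z => ?_⟩⟩
  · exact congrArg (w + ·) (rotation_apply a z)
  · exact congrArg (w + ·) (rotation_apply a (conj z))

lemma cos_angle_complex (x y z : ℂ) :
    Real.cos (EuclideanGeometry.angle x y z) * (‖x - y‖ * ‖z - y‖) =
      (x - y).re * (z - y).re + (x - y).im * (z - y).im := by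
  unfold EuclideanGeometry.angle
  rw [vsub_eq_sub, vsub_eq_sub, InnerProductGeometry.cos_angle_mul_norm_mul_norm, Complex.inner]
  simp [mul_re]
  ring

lemma vertexAngle_isometry (f : ℂ ≃ᵢ ℂ) (p : Fin 4 → ℂ) (i : Fin 4) :
    vertexAngle (fun k => f (p k)) i = vertexAngle p i := by
  unfold vertexAngle
  have := f.toRealAffineIsometryEquiv.toAffineIsometry.angle_map (p (i - 1)) (p i) (p (i + 1))
  simpa using this

/-- The metric content of the angle conditions: in coordinates in which the vertex `a` is `0` and
`d` is a positive real number, `C` being the vertex `c`. -/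
lemma coordinates_of_angles {α D l x y u v nb : ℝ} (hs : 0 < Real.sin α)
    (hc : 0 < Real.cos α) (hD : 0 < D) (hl : 0 < l) (hx : x = l * Real.cos α)
    (hy : y = l * Real.sin α) (hnb : 0 ≤ nb) (hnb2 : nb ^ 2 = (u - x) ^ 2 + (v - y) ^ 2)
    (hnb0 : nb ≠ 0)
    (hd : (u - D) * (0 - D) + (v - 0) * (0 - 0) = 0)
    (hcc : (x - u) * (D - u) + (y - v) * (0 - v) = 0)
    (hb : -Real.cos α * (l * nb) = (0 - x) * (u - x) + (0 - y) * (v - y)) :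
    u = D ∧ v = y ∧ 0 < D - x := by
  have hu : u = D := by
    have : (u - D) * D = 0 := by linarith
    rcases mul_eq_zero.1 this with h | h
    · linarith
    · exact absurd h hD.ne'
  subst hu
  have hsc := Real.sin_sq_add_cos_sq α
  have hv : (y - v) * v = 0 := by nlinarith
  rcases mul_eq_zero.1 hv with h | h
  · have hv' : v = y := by linarith
    subst hv'
    refine ⟨rfl, rfl, ?_⟩
    have h2 : nb = u - x := by
      rw [hx] at hb ⊢
      have h3 : l * Real.cos α * (nb - (u - l * Real.cos α)) = 0 := by nlinarith
      rcases mul_eq_zero.1 h3 with h | h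
      · exact absurd h (mul_pos hl hc).ne'
      · linarith
    rw [← h2]
    exact lt_of_le_of_ne hnb (Ne.symm hnb0)
  -- Here `c = d`. The right angles do not rule this out, because an angle with a zero side is `π /
  -- 2` by convention. But `a, b, c` would form a triangle whose angles at `a` and `b` already add
  -- up to `π`.
  · exfalso
    subst h
    subst hx hy
    have h1 : Real.cos α * nb = u * Real.cos α - l := by
      have h3 : l * (Real.cos α * nb - (u * Real.cos α - l)) = 0 := by
        linear_combination -hb - l ^ 2 * hsc
      rcases mul_eq_zero.1 h3 with h | h
      · exact absurd h hl.ne'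
      · linarith
    have h2 : (Real.cos α * nb) ^ 2 = (u * Real.cos α - l) ^ 2 := by rw [h1]
    have hss : Real.sin α ^ 2 = 1 - Real.cos α ^ 2 := by linarith
    have hn : nb ^ 2 = u ^ 2 - 2 * u * l * Real.cos α + l ^ 2 := by
      rw [hnb2]; ring_nf; rw [hss]; ring
    rw [mul_pow, hn] at h2
    have h4 : l * Real.sin α ^ 2 * (l - 2 * u * Real.cos α) = 0 := by
      rw [hss]; linear_combination -h2
    have h5 : l = 2 * u * Real.cos α := by
      rcases mul_eq_zero.1 h4 with h | h
      · exact absurd h (by positivity)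
      · linarith
    have h6 : 0 ≤ Real.cos α * nb := by positivity
    nlinarith [mul_pos hD hc]

lemma exists_stdVertex {α : ℝ} {p : Fin 4 → ℂ} (hp : IsRightTrapezoid α p) :
    ∃ ℓ B : ℝ, 0 < ℓ ∧ 0 < B ∧ ∃ ψ : ℂ ≃ᵢ ℂ, ∀ i, p i = ψ (stdVertex α ℓ B i) := by
  have hs : 0 < Real.sin α := Real.sin_pos_of_pos_of_lt_pi hp.pos (by linarith [Real.pi_pos, hp.lt])
  have hc : 0 < Real.cos α := Real.cos_pos_of_mem_Ioo ⟨by linarith [hp.pos, Real.pi_pos], hp.lt⟩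
  have ha : EuclideanGeometry.angle (p 3) (p 0) (p 1) = α := hp.angle_a
  have hb : EuclideanGeometry.angle (p 0) (p 1) (p 2) = Real.pi - α := hp.angle_b
  have hcc : EuclideanGeometry.angle (p 1) (p 2) (p 3) = Real.pi / 2 := hp.angle_c
  have hd : EuclideanGeometry.angle (p 2) (p 3) (p 0) = Real.pi / 2 := hp.angle_d
  have h30 : p 3 ≠ p 0 := fun h => by
    rw [h, EuclideanGeometry.angle_self_left] at ha; linarith [hp.lt]
  have h10 : p 1 ≠ p 0 := fun h => by
    rw [h, EuclideanGeometry.angle_self_right] at ha; linarith [hp.lt]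
  have h21 : p 2 ≠ p 1 := fun h => by
    rw [h, EuclideanGeometry.angle_self_right] at hb; linarith [hp.lt]
  have ca := cos_angle_complex (p 3) (p 0) (p 1)
  have cb := cos_angle_complex (p 0) (p 1) (p 2)
  have cc := cos_angle_complex (p 1) (p 2) (p 3)
  have cd := cos_angle_complex (p 2) (p 3) (p 0)
  rw [ha] at ca
  rw [hb, Real.cos_pi_sub] at cb
  rw [hcc, Real.cos_pi_div_two, zero_mul] at cc
  rw [hd, Real.cos_pi_div_two, zero_mul] at cd
  set D := ‖p 3 - p 0‖ with hD
  have hD0 : 0 < D := norm_pos_iff.2 (sub_ne_zero.2 h30)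
  set l := ‖p 1 - p 0‖ with hl
  have hl0 : 0 < l := norm_pos_iff.2 (sub_ne_zero.2 h10)
  obtain ⟨ζ, hζ, h3⟩ : ∃ ζ : ℂ, ‖ζ‖ = 1 ∧ p 3 = p 0 + ζ * D := by
    refine ⟨(p 3 - p 0) / D, ?_, ?_⟩
    · rw [norm_div, norm_real, Real.norm_eq_abs, abs_of_pos hD0, ← hD, div_self hD0.ne']
    · rw [div_mul_cancel₀ _ (ofReal_ne_zero.2 hD0.ne')]; ring
  have hζ1 : ζ * conj ζ = 1 := by rw [mul_conj, normSq_eq_norm_sq, hζ]; simp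
  have hζ2 : ζ.re ^ 2 + ζ.im ^ 2 = 1 := by
    rw [← one_pow 2, ← hζ, Complex.sq_norm, normSq_apply]; ring
  obtain ⟨y, h1⟩ : ∃ y : ℂ, p 1 = p 0 + ζ * y := by
    refine ⟨conj ζ * (p 1 - p 0), ?_⟩
    linear_combination (-(p 1 - p 0)) * hζ1
  obtain ⟨w, h2⟩ : ∃ w : ℂ, p 2 = p 0 + ζ * w := by
    refine ⟨conj ζ * (p 2 - p 0), ?_⟩
    linear_combination (-(p 2 - p 0)) * hζ1
  have inner_eq : ∀ a b : ℂ, (ζ * a).re * (ζ * b).re + (ζ * a).im * (ζ * b).im =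
      a.re * b.re + a.im * b.im := by
    intro a b
    simp only [mul_re, mul_im]
    linear_combination (a.re * b.re + a.im * b.im) * hζ2
  have e30 : p 3 - p 0 = ζ * D := by rw [h3]; ring
  have e10 : p 1 - p 0 = ζ * y := by rw [h1]; ring
  have e01 : p 0 - p 1 = ζ * (0 - y) := by rw [h1]; ring
  have e21 : p 2 - p 1 = ζ * (w - y) := by rw [h1, h2]; ring
  have e12 : p 1 - p 2 = ζ * (y - w) := by rw [h1, h2]; ring
  have e32 : p 3 - p 2 = ζ * (D - w) := by rw [h3, h2]; ring
  have e23 : p 2 - p 3 = ζ * (w - D) := by rw [h3, h2]; ring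
  have e03 : p 0 - p 3 = ζ * (0 - D) := by rw [h3]; ring
  rw [norm_sub_rev (p 0) (p 1), ← hl, e01, e21, inner_eq, norm_mul, hζ, one_mul] at cb
  rw [e12, e32, inner_eq] at cc
  rw [e23, e03, inner_eq] at cd
  rw [e30, e10, inner_eq] at ca
  have hly : l = ‖y‖ := by rw [hl, e10, norm_mul, hζ, one_mul]
  have hre : y.re = l * Real.cos α := by
    simp only [ofReal_re, ofReal_im] at ca
    have : D * (y.re - l * Real.cos α) = 0 := by linarith
    rcases mul_eq_zero.1 this with h | h
    · exact absurd h hD0.ne'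
    · linarith
  have him : y.im ^ 2 = (l * Real.sin α) ^ 2 := by
    have : l ^ 2 = y.re ^ 2 + y.im ^ 2 := by rw [hly, Complex.sq_norm, normSq_apply]; ring
    rw [hre] at this
    nlinarith [Real.sin_sq_add_cos_sq α]
  have hwy : ‖w - y‖ ≠ 0 := by
    intro h
    rw [norm_eq_zero.1 h, mul_zero] at e21
    exact h21 (sub_eq_zero.1 e21)
  have hwy2 : ‖w - y‖ ^ 2 = (w.re - y.re) ^ 2 + (w.im - y.im) ^ 2 := by
    rw [Complex.sq_norm, normSq_apply]; simp only [sub_re, sub_im]; ring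
  simp only [sub_re, sub_im, zero_re, zero_im, ofReal_re, ofReal_im] at cb cc cd
  obtain ⟨⟨ψ, hψ⟩, ⟨ψ', hψ'⟩⟩ := exists_isometry (p 0) ζ hζ
  -- The unoriented angle at `a` determines the position of `b` only up to reflection in the line
  -- `ad`; the second sign is treated with the orientation-reversing isometry `ψ'`.
  rcases sq_eq_sq_iff_eq_or_eq_neg.1 him with him | him
  · obtain ⟨k1, k2, k3⟩ := coordinates_of_angles (α := α) (D := D) (l := l) (x := y.re) (y := y.im)
      (u := w.re) (v := w.im) (nb := ‖w - y‖) hs hc hD0 hl0 hre him (norm_nonneg _) hwy2 hwy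
      (by linarith) (by linarith) (by linarith)
    refine ⟨l, D - y.re, hl0, k3, ψ, fun i => ?_⟩
    rw [hψ]
    match i with
    | 0 =>
      simp [stdVertex]
    | 1 =>
      rw [h1]
      congr 2
      apply Complex.ext <;> simp [stdVertex, hre, him]
    | 2 =>
      rw [h2]
      congr 2
      apply Complex.ext <;> simp [stdVertex, hre, him, k1, k2]
    | 3 =>
      rw [h3]
      congr 2
      apply Complex.ext <;> simp [stdVertex, hre]
  · obtain ⟨k1, k2, k3⟩ := coordinates_of_angles (α := α) (D := D) (l := l) (x := y.re) (y := -y.im)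
      (u := w.re) (v := -w.im) (nb := ‖w - y‖) hs hc hD0 hl0 hre (by linarith) (norm_nonneg _)
      (by rw [hwy2]; ring) hwy (by linarith) (by linarith) (by linarith)
    refine ⟨l, D - y.re, hl0, k3, ψ', fun i => ?_⟩
    rw [hψ']
    match i with
    | 0 =>
      simp [stdVertex]
    | 1 =>
      rw [h1]
      congr 2
      apply Complex.ext <;> simp [stdVertex, hre, him]
    | 2 =>
      rw [h2]
      congr 2
      apply Complex.ext <;> simp [stdVertex, hre, k1]; linarith
    | 3 =>
      rw [h3]
      congr 2
      apply Complex.ext <;> simp [stdVertex, hre]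

/-! ### Germs and cones under isometries -/

lemma HasGerm.image {T C C' : Set ℂ} {u : ℂ} (f : ℂ ≃ᵢ ℂ)
    (hC : ∀ z, f z - f u ∈ C' ↔ z - u ∈ C) (h : HasGerm T u C) : HasGerm (f '' T) (f u) C' := by
  have hf : Tendsto f.symm (𝓝 (f u)) (𝓝 u) := by
    have := f.symm.continuous.tendsto (f u)
    rwa [f.symm_apply_apply] at this
  filter_upwards [hf.eventually h] with z hz
  rw [← hC, f.apply_symm_apply] at hz
  rw [← hz]
  constructor
  · rintro ⟨y, hy, rfl⟩; simpa using hy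
  · exact fun hy => ⟨_, hy, f.apply_symm_apply z⟩

lemma conj_mul_self_of_norm {ζ : ℂ} (hζ : ‖ζ‖ = 1) : conj ζ * ζ = 1 := by
  rw [mul_comm, mul_conj, normSq_eq_norm_sq, hζ]; simp

lemma conj_mul_rotate {ζ : ℂ} (hζ : ‖ζ‖ = 1) (X w : ℂ) :
    conj (ζ * X) * (ζ * w) = conj X * w := by
  rw [map_mul]; linear_combination conj X * w * conj_mul_self_of_norm hζ

lemma mem_cone_rotate {ζ : ℂ} (hζ : ‖ζ‖ = 1) (X w : ℂ) (L : ℝ) :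
    ζ * w ∈ cone (ζ * X) L ↔ w ∈ cone X L := by
  simp only [cone, Set.mem_ofPred_eq, conj_mul_rotate hζ]

lemma mem_openCone_rotate {ζ : ℂ} (hζ : ‖ζ‖ = 1) (X w : ℂ) (L : ℝ) :
    ζ * w ∈ openCone (ζ * X) L ↔ w ∈ openCone X L := by
  simp only [openCone, Set.mem_ofPred_eq, conj_mul_rotate hζ]

/-- A reflection swaps the two sides of an angle, so the clockwise side of the image comes from the
counterclockwise side `X * exp (L * I)`. Conjugating and turning by `L` exchanges the two
inequalities that define a cone. -/
lemma conj_mul_reflect {ζ : ℂ} (hζ : ‖ζ‖ = 1) (X w : ℂ) (L : ℝ) :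
    conj (ζ * conj (X * exp (L * I))) * (ζ * conj w) = conj (conj X * w) * exp (L * I) := by
  simp only [map_mul, conj_conj]
  linear_combination X * exp (L * I) * conj w * conj_mul_self_of_norm hζ

lemma mem_cone_reflect {ζ : ℂ} (hζ : ‖ζ‖ = 1) (X w : ℂ) (L : ℝ) :
    ζ * conj w ∈ cone (ζ * conj (X * exp (L * I))) L ↔ w ∈ cone X L := by
  simp only [cone, Set.mem_ofPred_eq, conj_mul_reflect hζ]
  generalize conj X * w = v
  have hsc := Real.sin_sq_add_cos_sq L
  simp only [mul_im, mul_re, conj_re, conj_im, exp_ofReal_mul_I_re, exp_ofReal_mul_I_im]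
  constructor
  · rintro ⟨h1, h2⟩
    exact ⟨by linear_combination h2 + v.im * hsc, by linear_combination h1⟩
  · rintro ⟨h1, h2⟩
    exact ⟨by linear_combination h2, by linear_combination h1 - v.im * hsc⟩

lemma mem_openCone_reflect {ζ : ℂ} (hζ : ‖ζ‖ = 1) (X w : ℂ) (L : ℝ) :
    ζ * conj w ∈ openCone (ζ * conj (X * exp (L * I))) L ↔ w ∈ openCone X L := by
  simp only [openCone, Set.mem_ofPred_eq, conj_mul_reflect hζ]
  generalize conj X * w = v
  have hsc := Real.sin_sq_add_cos_sq L
  simp only [mul_im, mul_re, conj_re, conj_im, exp_ofReal_mul_I_re, exp_ofReal_mul_I_im]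
  constructor
  · rintro ⟨h1, h2⟩
    exact ⟨by linear_combination h2 + v.im * hsc, by linear_combination h1⟩
  · rintro ⟨h1, h2⟩
    exact ⟨by linear_combination h2, by linear_combination h1 - v.im * hsc⟩

lemma norm_reflect {ζ X : ℂ} (hζ : ‖ζ‖ = 1) (hX : ‖X‖ = 1) (L : ℝ) :
    ‖ζ * conj (X * exp (L * I))‖ = 1 := by
  simp [hζ, hX, norm_exp_ofReal_mul_I]

/-- An isometry carries a system of cones with unit directions to such a system. -/
lemma exists_cone_map (f : ℂ ≃ᵢ ℂ) (u X : ℂ) (hX : ‖X‖ = 1) (L : ℝ) :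
    ∃ X' : ℂ, ‖X'‖ = 1 ∧ ∀ z, f z - f u ∈ cone X' L ↔ z - u ∈ cone X L := by
  obtain ⟨w, ζ, hζ, h | h⟩ := isometry_form f
  · refine ⟨ζ * X, by simp [hζ, hX], fun z => ?_⟩
    have hd : f z - f u = ζ * (z - u) := by rw [h, h]; ring
    rw [hd, mem_cone_rotate hζ]
  · refine ⟨ζ * conj (X * exp (L * I)), norm_reflect hζ hX L, fun z => ?_⟩
    have hd : f z - f u = ζ * conj (z - u) := by rw [h, h, map_sub]; ring
    rw [hd, mem_cone_reflect hζ]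

lemma FlatGerm.image {T : Set ℂ} {u : ℂ} (f : ℂ ≃ᵢ ℂ) (h : FlatGerm T u) :
    FlatGerm (f '' T) (f u) := by
  rcases h with h | ⟨X, hX, h⟩ | h
  · exact Or.inl (h.image f (by simp))
  · obtain ⟨X', hX', hc⟩ := exists_cone_map f u X hX Real.pi
    exact Or.inr (Or.inl ⟨X', hX', h.image f hc⟩)
  · exact Or.inr (Or.inr (h.image f (by simp)))

/-! ### Local data of a tile -/

/-- The local data of a tile `T` with vertices `v 0, …, v 3` and center `m`: its angles at `v 0` and
`v 1` have clockwise sides with directions `X` and `Y`. -/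
structure IsTileFrame (α : ℝ) (T : Set ℂ) (v : Fin 4 → ℂ) (m X Y : ℂ) : Prop where
  norm_X : ‖X‖ = 1
  norm_Y : ‖Y‖ = 1
  dir : Y * exp ((Real.pi - α : ℝ) * I) = X ∨ Y * exp ((Real.pi - α : ℝ) * I) = -X
  edge : (v 1 - v 0) / (dist (v 0) (v 1) : ℂ) = X ∨
    (v 1 - v 0) / (dist (v 0) (v 1) : ℂ) = X * exp (α * I)
  germ_a : HasGerm T (v 0) (cone X α)
  germ_b : HasGerm T (v 1) (cone Y (Real.pi - α))
  center_a : m - v 0 ∈ openCone X α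
  center_b : m - v 1 ∈ openCone Y (Real.pi - α)
  germ_right : ∀ u, u = v 2 ∨ u = v 3 → ∃ Z : ℂ, ‖Z‖ = 1 ∧ HasGerm T u (cone Z (Real.pi / 2))
  germ_flat : ∀ u, (∀ i, u ≠ v i) → FlatGerm T u

lemma exp_eq_mk (t : ℝ) : exp (t * I) = ⟨Real.cos t, Real.sin t⟩ := by
  apply Complex.ext
  · rw [exp_ofReal_mul_I_re]
  · rw [exp_ofReal_mul_I_im]

lemma exp_pi_sub (t : ℝ) : exp ((Real.pi - t : ℝ) * I) = -conj (exp (t * I)) := by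
  rw [exp_eq_mk, exp_eq_mk]
  apply Complex.ext <;> simp

lemma stdVertex_injective {α ℓ B : ℝ} (h0 : 0 < α) (h1 : α < Real.pi / 2) (hℓ : 0 < ℓ)
    (hB : 0 < B) : Function.Injective (stdVertex α ℓ B) := by
  have hs : 0 < Real.sin α := Real.sin_pos_of_pos_of_lt_pi h0 (by linarith [Real.pi_pos])
  have hc : 0 < Real.cos α := Real.cos_pos_of_mem_Ioo ⟨by linarith, h1⟩
  have hlc := mul_pos hℓ hc
  intro i j hij
  rw [Complex.ext_iff] at hij
  fin_cases i <;> fin_cases j <;>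
    simp [stdVertex, hℓ.ne', hs.ne', hc.ne', hB.ne'] at hij ⊢ <;> linarith

lemma vertex_injective {α : ℝ} {p : Fin 4 → ℂ} (hp : IsRightTrapezoid α p) :
    Function.Injective p := by
  obtain ⟨ℓ, B, hℓ, hB, ψ, hψ⟩ := exists_stdVertex hp
  rw [show p = ψ ∘ stdVertex α ℓ B from funext hψ]
  exact ψ.injective.comp (stdVertex_injective hp.pos hp.lt hℓ hB)

/-- For a direct isometry, `X` runs along the longer base and `Y` points from `b` back to `a`. For a
reversing one, `X` runs along the hypotenuse and `Y` along the shorter base. In both cases the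
counterclockwise side at `b` is parallel to `X`: it is `X` in the first case and `-X` in the second.
-/
lemma exists_frame_std {α ℓ B : ℝ} (h0 : 0 < α) (h1 : α < Real.pi / 2) (hℓ : 0 < ℓ) (hB : 0 < B)
    (f : ℂ ≃ᵢ ℂ) : ∃ X Y : ℂ, IsTileFrame α (f '' region (stdVertex α ℓ B))
      (fun i => f (stdVertex α ℓ B i))
      (f ((stdVertex α ℓ B 0 + stdVertex α ℓ B 1 + stdVertex α ℓ B 2 + stdVertex α ℓ B 3) / 4))
      X Y := by
  have hs : 0 < Real.sin α := Real.sin_pos_of_pos_of_lt_pi h0 (by linarith [Real.pi_pos])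
  have hc : 0 < Real.cos α := Real.cos_pos_of_mem_Ioo ⟨by linarith, h1⟩
  have hsc : Real.sin α ^ 2 + Real.cos α ^ 2 = 1 := Real.sin_sq_add_cos_sq α
  have hlc := mul_pos hℓ hc
  have hls := mul_pos hℓ hs
  have hBs := mul_pos hB hs
  have hinj := stdVertex_injective h0 h1 hℓ hB
  have germ := stdVertex_germ h0 h1 hℓ hB
  set q := stdVertex α ℓ B with hq
  set m := (q 0 + q 1 + q 2 + q 3) / 4 with hm
  have hω1 : ‖exp (α * I)‖ = 1 := norm_exp_ofReal_mul_I α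
  have hω2 := conj_mul_self_of_norm hω1
  have hq10 : q 1 = q 0 + ℓ * exp (α * I) := by
    rw [exp_eq_mk, hq]; apply Complex.ext <;> simp [stdVertex]
  have hdist : dist (f (q 0)) (f (q 1)) = ℓ := by
    rw [f.isometry.dist_eq, hq10, dist_self_add_right, norm_mul, hω1, norm_real, Real.norm_eq_abs,
      abs_of_pos hℓ, mul_one]
  have hℓ' : (ℓ : ℂ) ≠ 0 := ofReal_ne_zero.2 hℓ.ne'
  have g0 : HasGerm (region q) (q 0) (cone 1 α) := by
    rcases germ (q 0) with h | h | h | h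
    · exact h.2
    · exact absurd (hinj h.1) (by decide)
    · rcases h.1 with h | h <;> exact absurd (hinj h) (by decide)
    · exact absurd rfl (h.1 0)
  have g1 : HasGerm (region q) (q 1) (cone (-exp (α * I)) (Real.pi - α)) := by
    rw [exp_eq_mk]
    rcases germ (q 1) with h | h | h | h
    · exact absurd (hinj h.1) (by decide)
    · exact h.2
    · rcases h.1 with h | h <;> exact absurd (hinj h) (by decide)
    · exact absurd rfl (h.1 1)
  have g2 : ∀ u, u = q 2 ∨ u = q 3 →
      ∃ Z : ℂ, ‖Z‖ = 1 ∧ HasGerm (region q) u (cone Z (Real.pi / 2)) := by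
    intro u hu
    rcases germ u with h | h | h | h
    · exfalso
      rcases hu with hu | hu <;> rw [hu] at h <;> exact absurd (hinj h.1) (by decide)
    · exfalso
      rcases hu with hu | hu <;> rw [hu] at h <;> exact absurd (hinj h.1) (by decide)
    · exact h.2
    · exfalso
      rcases hu with hu | hu
      exacts [h.1 2 hu, h.1 3 hu]
  have g3 : ∀ u, (∀ i, u ≠ q i) → FlatGerm (region q) u := by
    intro u hu
    rcases germ u with h | h | h | h
    · exact absurd h.1 (hu 0)
    · exact absurd h.1 (hu 1)
    · rcases h.1 with h | h
      exacts [absurd h (hu 2), absurd h (hu 3)]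
    · exact h.2
  have c0 : m - q 0 ∈ openCone 1 α := by
    simp [openCone, hm, hq, stdVertex]
    constructor <;> nlinarith
  have c1 : m - q 1 ∈ openCone (-exp (α * I)) (Real.pi - α) := by
    have e1 : (m - q 1).re = (2 * B - ℓ * Real.cos α) / 4 := by simp [hm, hq, stdVertex]; ring
    have e2 : (m - q 1).im = -(ℓ * Real.sin α) / 2 := by simp [hm, hq, stdVertex]; ring
    have hss : Real.sin α ^ 2 = 1 - Real.cos α ^ 2 := by linarith
    simp only [openCone, Set.mem_ofPred_eq, map_neg, mul_im, mul_re, neg_re, neg_im, conj_re,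
      conj_im, exp_ofReal_mul_I_re, exp_ofReal_mul_I_im, e1, e2, Real.cos_pi_sub, Real.sin_pi_sub]
    constructor <;> nlinarith
  have hright : ∀ u, u = f (q 2) ∨ u = f (q 3) →
      ∃ Z : ℂ, ‖Z‖ = 1 ∧ HasGerm (f '' region q) u (cone Z (Real.pi / 2)) := by
    intro u hu
    obtain ⟨y, rfl⟩ := f.surjective u
    obtain ⟨Z, hZ, hg⟩ := g2 y (by simpa [f.injective.eq_iff] using hu)
    obtain ⟨Z', hZ', hc⟩ := exists_cone_map f y Z hZ (Real.pi / 2)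
    exact ⟨Z', hZ', hg.image f hc⟩
  have hflat : ∀ u, (∀ i, u ≠ f (q i)) → FlatGerm (f '' region q) u := by
    intro u hu
    obtain ⟨y, rfl⟩ := f.surjective u
    exact (g3 y fun i h => hu i (by rw [h])).image f
  obtain ⟨w, ζ, hζ, h | h⟩ := isometry_form f
  · have hd : ∀ z y, f z - f y = ζ * (z - y) := fun z y => by rw [h, h]; ring
    refine ⟨ζ, -(ζ * exp (α * I)), hζ, by simp [hζ, hω1], Or.inl ?_, Or.inr ?_, ?_, ?_, ?_, ?_,
      hright, hflat⟩
    · rw [exp_pi_sub]; linear_combination ζ * hω2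
    · rw [hdist, hd, hq10]; field_simp; ring
    · refine g0.image f fun z => ?_
      have := mem_cone_rotate hζ 1 (z - q 0) α
      rwa [mul_one, ← hd] at this
    · refine g1.image f fun z => ?_
      rw [hd, ← mul_neg, mem_cone_rotate hζ]
    · have := (mem_openCone_rotate hζ 1 (m - q 0) α).2 c0
      rwa [mul_one, ← hd] at this
    · rw [hd, ← mul_neg, mem_openCone_rotate hζ]; exact c1
  · have hd : ∀ z y, f z - f y = ζ * conj (z - y) := fun z y => by rw [h, h, map_sub]; ring
    have r0 : ζ * conj (1 * exp (α * I)) = ζ * conj (exp (α * I)) := by rw [one_mul]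
    have r1 : ζ * conj (-exp (α * I) * exp ((Real.pi - α : ℝ) * I)) = ζ := by
      rw [exp_pi_sub, neg_mul_neg, mul_comm (exp _), hω2, map_one, mul_one]
    refine ⟨ζ * conj (exp (α * I)), ζ, by simp [hζ, hω1], hζ, Or.inr ?_, Or.inl ?_, ?_, ?_, ?_, ?_,
      hright, hflat⟩
    · rw [exp_pi_sub]; ring
    · rw [hdist, hd, hq10, add_sub_cancel_left, map_mul, conj_ofReal]; field_simp
    · refine g0.image f fun z => ?_
      rw [hd, ← r0, mem_cone_reflect hζ]
    · refine g1.image f fun z => ?_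
      have := mem_cone_reflect hζ (-exp (α * I)) (z - q 1) (Real.pi - α)
      rwa [r1, ← hd] at this
    · rw [hd, ← r0, mem_openCone_reflect hζ]; exact c0
    · rw [hd]
      have := (mem_openCone_reflect hζ (-exp (α * I)) (m - q 1) (Real.pi - α)).2 c1
      rwa [r1] at this

lemma exists_frame {α : ℝ} {p : Fin 4 → ℂ} (hp : IsRightTrapezoid α p) (f : ℂ ≃ᵢ ℂ) :
    ∃ X Y : ℂ, IsTileFrame α (f '' region p) (fun i => f (p i))
      (f ((p 0 + p 1 + p 2 + p 3) / 4)) X Y := by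
  obtain ⟨ℓ, B, hℓ, hB, ψ, hψ⟩ := exists_stdVertex hp
  obtain ⟨X, Y, h⟩ := exists_frame_std hp.pos hp.lt hℓ hB (ψ.trans f)
  refine ⟨X, Y, ?_⟩
  have e1 : region p = ψ '' region (stdVertex α ℓ B) := by
    have : p = ψ ∘ stdVertex α ℓ B := funext hψ
    rw [this, region, region, Set.range_comp]
    have h := (ψ.toRealAffineIsometryEquiv.toAffineEquiv.toAffineMap.image_convexHull
      (Set.range (stdVertex α ℓ B))).symm
    simpa using h
  have e2 : (p 0 + p 1 + p 2 + p 3) / 4 = ψ ((stdVertex α ℓ B 0 + stdVertex α ℓ B 1 +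
      stdVertex α ℓ B 2 + stdVertex α ℓ B 3) / 4) := by
    simp only [hψ]
    obtain ⟨w, ζ, -, h | h⟩ := isometry_form ψ
    · simp only [h]; ring
    · simp only [h, map_div₀, map_add, map_ofNat]; ring
  rw [e1, e2, ← Set.image_comp]
  have e3 : (fun i => f (p i)) = fun i => (ψ.trans f) (stdVertex α ℓ B i) :=
    funext fun i => by rw [hψ]; rfl
  rw [e3]
  exact h

/-! ### Integrals over small sectors -/

lemma isClosed_cone (X : ℂ) (L : ℝ) : IsClosed (cone X L) := by
  unfold cone
  refine IsClosed.and ?_ ?_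
  · exact isClosed_le (by fun_prop) (by fun_prop)
  · exact isClosed_le (by fun_prop) (by fun_prop)

lemma polar_mem_cone {L ρ θ : ℝ} (hL : 0 < L) (hLπ : L ≤ Real.pi) (hρ : 0 < ρ)
    (hθ : θ ∈ Set.Ioo (-Real.pi) Real.pi) :
    (ρ * (Real.cos θ + Real.sin θ * I) : ℂ) ∈ cone 1 L ↔ θ ∈ Set.Icc 0 L := by
  have e1 : (ρ * (Real.cos θ + Real.sin θ * I) : ℂ).re = ρ * Real.cos θ := by
    simp [-ofReal_cos, -ofReal_sin]
  have e2 : (ρ * (Real.cos θ + Real.sin θ * I) : ℂ).im = ρ * Real.sin θ := by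
    simp [-ofReal_cos, -ofReal_sin]
  simp only [cone, map_one, one_mul, Set.mem_ofPred_eq, e1, e2]
  have e3 : ρ * Real.sin θ * Real.cos L ≤ ρ * Real.cos θ * Real.sin L ↔ Real.sin (θ - L) ≤ 0 := by
    rw [Real.sin_sub]
    constructor
    · intro h
      by_contra! hc
      nlinarith [mul_pos hρ hc]
    · intro h
      nlinarith [mul_nonneg hρ.le (neg_nonneg.2 h)]
  rw [e3, mul_nonneg_iff_of_pos_left hρ]
  constructor
  · rintro ⟨h1, h2⟩
    have h0 : 0 ≤ θ := by
      by_contra! hc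
      linarith [Real.sin_neg_of_neg_of_neg_pi_lt hc hθ.1]
    refine ⟨h0, ?_⟩
    by_contra! hc
    linarith [Real.sin_pos_of_pos_of_lt_pi (sub_pos.2 hc) (by linarith [hθ.2])]
  · rintro ⟨h1, h2⟩
    exact ⟨Real.sin_nonneg_of_nonneg_of_le_pi h1 (by linarith),
      Real.sin_nonpos_of_nonpos_of_neg_pi_le (by linarith) (by linarith)⟩

/-- In polar coordinates the sector is a rectangle, so the integral splits into a radial and an
angular factor. -/
lemma integral_pow_cone (n : ℕ) {L r : ℝ} (hL : 0 < L) (hLπ : L ≤ Real.pi) (hr : 0 < r) :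
    ∫ z in cone 1 L ∩ Metric.ball 0 r, z ^ n =
      (∫ ρ in (0 : ℝ)..r, (ρ : ℂ) ^ (n + 1)) * ∫ θ in (0 : ℝ)..L, exp (n * I * θ) := by
  have hm : MeasurableSet (cone 1 L ∩ Metric.ball (0 : ℂ) r) :=
    (isClosed_cone 1 L).measurableSet.inter measurableSet_ball
  rw [← integral_indicator hm, ← Complex.integral_comp_polarCoord_symm]
  have key : ∀ p ∈ polarCoord.target,
      p.1 • (cone 1 L ∩ Metric.ball (0 : ℂ) r).indicator (fun z => z ^ n)
        (Complex.polarCoord.symm p) =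
      (Set.Ioo 0 r ×ˢ Set.Icc 0 L).indicator
        (fun p : ℝ × ℝ => (p.1 : ℂ) ^ (n + 1) * exp (n * I * p.2)) p := by
    rintro ⟨ρ, θ⟩ hp
    rw [polarCoord_target] at hp
    obtain ⟨hρ, hθ⟩ := hp
    simp only [Set.mem_Ioi] at hρ
    have hmem : Complex.polarCoord.symm (ρ, θ) ∈ cone 1 L ∩ Metric.ball (0 : ℂ) r ↔
        (ρ, θ) ∈ Set.Ioo 0 r ×ˢ Set.Icc 0 L := by
      rw [Set.mem_inter_iff, mem_ball_zero_iff, Complex.norm_polarCoord_symm, abs_of_pos hρ,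
        Complex.polarCoord_symm_apply, polar_mem_cone hL hLπ hρ hθ, Set.mem_prod, Set.mem_Ioo]
      simp only [hρ, true_and, and_comm]
    by_cases h : (ρ, θ) ∈ Set.Ioo 0 r ×ˢ Set.Icc 0 L
    · rw [Set.indicator_of_mem h, Set.indicator_of_mem (hmem.2 h), Complex.polarCoord_symm_apply,
        mul_pow, real_smul]
      have : (Real.cos θ + Real.sin θ * I : ℂ) = exp (θ * I) := by
        rw [exp_mul_I, ofReal_cos, ofReal_sin]
      simp only [this, ← exp_nat_mul]
      rw [pow_succ, show (n : ℂ) * (θ * I) = n * I * θ by ring]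
      ring
    · rw [Set.indicator_of_notMem h, Set.indicator_of_notMem (fun h' => h (hmem.1 h')), smul_zero]
  rw [setIntegral_congr_fun polarCoord.open_target.measurableSet key,
    setIntegral_indicator (measurableSet_Ioo.prod measurableSet_Icc), polarCoord_target,
    Set.prod_inter_prod]
  have h1 : Set.Ioi 0 ∩ Set.Ioo 0 r = Set.Ioo 0 r :=
    Set.inter_eq_right.2 Set.Ioo_subset_Ioi_self
  -- For `L = π` the polar chart misses the bounding ray `θ = π`, which is a null set of angles.
  have h2 : (Set.Ioo (-Real.pi) Real.pi ∩ Set.Icc 0 L : Set ℝ) =ᵐ[volume] Set.Ioc 0 L := by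
    have : (Set.Ioo (-Real.pi) Real.pi : Set ℝ) =ᵐ[volume] Set.Icc (-Real.pi) Real.pi :=
      Ioo_ae_eq_Icc
    have h3 := this.inter (Filter.EventuallyEq.refl (ae volume) (Set.Icc 0 L))
    rw [Set.inter_eq_right.2 (Set.Icc_subset_Icc (by linarith [Real.pi_pos]) hLπ)] at h3
    exact h3.trans Ioc_ae_eq_Icc.symm
  rw [h1, show (volume : Measure (ℝ × ℝ)) = volume.prod volume from rfl,
    setIntegral_prod_mul (fun ρ : ℝ => (ρ : ℂ) ^ (n + 1)) (fun θ : ℝ => exp (n * I * θ)),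
    setIntegral_congr_set h2, intervalIntegral.integral_of_le hr.le,
    intervalIntegral.integral_of_le hL.le, ← integral_Ioc_eq_integral_Ioo]

lemma setIntegral_rotate {ζ : ℂ} (hζ : ‖ζ‖ = 1) (u : ℂ) (s : Set ℂ) (g : ℂ → ℂ) :
    ∫ w in (fun w => u + ζ * w) ⁻¹' s, g (u + ζ * w) = ∫ z in s, g z := by
  let a : Circle := ⟨ζ, by simp [Submonoid.unitSphere, hζ]⟩
  have h1 : MeasurePreserving (fun w : ℂ => u + ζ * w) volume volume :=
    (measurePreserving_add_left volume u).comp (rotation a).measurePreserving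
  have h2 : MeasurableEmbedding (fun w : ℂ => u + ζ * w) := by
    obtain ⟨⟨ψ, hψ⟩, -⟩ := exists_isometry u ζ hζ
    have : (fun w : ℂ => u + ζ * w) = ψ := funext fun z => (hψ z).symm
    rw [this]
    exact ψ.toHomeomorph.measurableEmbedding
  exact h1.setIntegral_preimage_emb h2 g s

lemma HasGerm.inter_ball {T C : Set ℂ} {u : ℂ} (h : HasGerm T u C) :
    ∀ᶠ r in 𝓝[>] (0 : ℝ), T ∩ Metric.ball u r = {z | z - u ∈ C} ∩ Metric.ball u r := by
  obtain ⟨ε, hε, hb⟩ := Metric.eventually_nhds_iff_ball.1 h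
  filter_upwards [Ioo_mem_nhdsGT hε] with r hr
  ext z
  simp only [Set.mem_inter_iff, Set.mem_ofPred_eq, and_congr_left_iff]
  exact fun hz => hb z (Metric.ball_subset_ball hr.2.le hz)

/-- Rotating the cone to direction `1` pulls out `X ^ n`. The exponent `0` yields areas, hence angle
sums; the exponent `4` yields the invariant `X ^ 4`. -/
lemma HasGerm.integral_pow {T : Set ℂ} {u X : ℂ} {L : ℝ} (h : HasGerm T u (cone X L))
    (hX : ‖X‖ = 1) (hL : 0 < L) (hLπ : L ≤ Real.pi) (n : ℕ) :
    ∀ᶠ r in 𝓝[>] (0 : ℝ), ∫ z in T ∩ Metric.ball u r, (z - u) ^ n =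
      X ^ n * ((∫ ρ in (0 : ℝ)..r, (ρ : ℂ) ^ (n + 1)) *
        ∫ θ in (0 : ℝ)..L, exp (n * I * θ)) := by
  filter_upwards [h.inter_ball, self_mem_nhdsWithin] with r hr hr0
  rw [hr, ← integral_pow_cone n hL hLπ hr0, ← setIntegral_rotate hX u, ← integral_const_mul]
  have : (fun w => u + X * w) ⁻¹' ({z | z - u ∈ cone X L} ∩ Metric.ball u r) =
      cone 1 L ∩ Metric.ball 0 r := by
    ext w
    have := mem_cone_rotate hX 1 w L
    rw [mul_one] at this
    simp [this, hX]
  rw [this]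
  simp only [add_sub_cancel_left, mul_pow]

/-- The value of `∫ (z - u) ^ 4` on a small disc centered at `u`, for a region with one angle `L`
at `u`, up to a power of the direction of the angle. -/
lemma HasGerm.integral_pow_four {T : Set ℂ} {u X : ℂ} {L : ℝ} (h : HasGerm T u (cone X L))
    (hX : ‖X‖ = 1) (hL : 0 < L) (hLπ : L ≤ Real.pi) :
    ∀ᶠ r in 𝓝[>] (0 : ℝ), ∫ z in T ∩ Metric.ball u r, (z - u) ^ 4 =
      (∫ ρ in (0 : ℝ)..r, (ρ : ℂ) ^ 5) / (4 * I) * (X ^ 4 * (exp (L * I) ^ 4 - 1)) := by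
  filter_upwards [h.integral_pow hX hL hLπ 4] with r hr
  rw [hr, integral_exp_mul_complex (by simp), ← exp_nat_mul]
  simp only [ofReal_zero, mul_zero, exp_zero, Nat.cast_ofNat]
  rw [show (4 : ℂ) * I * L = 4 * (L * I) by ring]
  ring

lemma radial_integral_ne_zero {r : ℝ} (hr : 0 < r) :
    (∫ ρ in (0 : ℝ)..r, (ρ : ℂ) ^ 5) / (4 * I) ≠ 0 := by
  have : ∫ ρ in (0 : ℝ)..r, (ρ : ℂ) ^ 5 = ((∫ ρ in (0 : ℝ)..r, ρ ^ 5 : ℝ) : ℂ) := by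
    rw [← intervalIntegral.integral_ofReal]; simp
  rw [this, integral_pow]
  refine div_ne_zero (ofReal_ne_zero.2 ?_) (by simp)
  have : 0 < r ^ 6 := by positivity
  norm_num
  exact hr.ne'

lemma HasGerm.area {T : Set ℂ} {u X : ℂ} {L : ℝ} (h : HasGerm T u (cone X L))
    (hX : ‖X‖ = 1) (hL : 0 < L) (hLπ : L ≤ Real.pi) :
    ∀ᶠ r in 𝓝[>] (0 : ℝ), volume.real (T ∩ Metric.ball u r) = L * (r ^ 2 / 2) := by
  filter_upwards [h.integral_pow hX hL hLπ 0] with r hr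
  have e : ∫ ρ in (0 : ℝ)..r, (ρ : ℂ) ^ 1 = ((∫ ρ in (0 : ℝ)..r, ρ ^ 1 : ℝ) : ℂ) := by
    rw [← intervalIntegral.integral_ofReal]; simp
  simp only [pow_zero, zero_add, CharP.cast_eq_zero, zero_mul, exp_zero, one_mul, e,
    _root_.integral_pow, intervalIntegral.integral_const, setIntegral_const, real_smul, mul_one,
    sub_zero] at hr
  have h2 := congrArg Complex.re hr
  rw [← ofReal_mul, ofReal_re, ofReal_re] at h2
  rw [h2]; norm_num; ring

/-- The integral of `(z - u) ^ 4` over a small disc intersected with `T` vanishes. -/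
def Balanced (T : Set ℂ) (u : ℂ) : Prop :=
  ∀ᶠ r in 𝓝[>] (0 : ℝ), ∫ z in T ∩ Metric.ball u r, (z - u) ^ 4 = 0

/-- The exponent `4` is chosen so that right and straight angles become invisible: for them `exp (L
* I) ^ 4 = 1`. -/
lemma balanced_of_cone {T : Set ℂ} {u X : ℂ} {L : ℝ} (h : HasGerm T u (cone X L))
    (hX : ‖X‖ = 1) (hL : 0 < L) (hLπ : L ≤ Real.pi) (h4 : exp (L * I) ^ 4 = 1) :
    Balanced T u := by
  filter_upwards [h.integral_pow_four hX hL hLπ] with r hr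
  rw [hr, h4]; ring

lemma exp_half_pi_pow_four : exp ((Real.pi / 2 : ℝ) * I) ^ 4 = 1 := by
  rw [← exp_nat_mul]
  convert exp_two_pi_mul_I using 2
  push_cast; ring

lemma exp_pi_pow_four : exp ((Real.pi : ℝ) * I) ^ 4 = 1 := by
  rw [exp_pi_mul_I]; norm_num

lemma balanced_of_empty {T : Set ℂ} {u : ℂ} (h : HasGerm T u ∅) : Balanced T u := by
  filter_upwards [h.inter_ball] with r hr
  rw [hr]; simp

lemma balanced_of_univ {T : Set ℂ} {u : ℂ} (h : HasGerm T u Set.univ) : Balanced T u := by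
  filter_upwards [h.inter_ball] with r hr
  rw [hr]
  simp only [Set.mem_univ, Set.ofPred_true, Set.univ_inter]
  -- A full disc is not covered by the cone formula, which needs `L ≤ π`. Instead, rotation by `π /
  -- 4` preserves the disc and changes the sign of the integrand, as `ζ ^ 4 = -1`.
  set ζ := exp ((Real.pi / 4 : ℝ) * I) with hζ
  have hζ1 : ‖ζ‖ = 1 := norm_exp_ofReal_mul_I _
  have hζ4 : ζ ^ 4 = -1 := by
    rw [hζ, ← exp_nat_mul, ← exp_pi_mul_I]; congr 1; push_cast; ring
  have h1 := setIntegral_rotate hζ1 u (Metric.ball u r) (fun z => (z - u) ^ 4)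
  have h2 := setIntegral_rotate (ζ := 1) (by simp) u (Metric.ball u r) (fun z => (z - u) ^ 4)
  have e1 : (fun w => u + ζ * w) ⁻¹' Metric.ball u r = Metric.ball 0 r := by
    ext w; simp [hζ1]
  have e2 : (fun w => u + 1 * w) ⁻¹' Metric.ball u r = Metric.ball 0 r := by
    ext w; simp
  rw [e1] at h1
  rw [e2] at h2
  simp only [add_sub_cancel_left, mul_pow, hζ4, neg_one_mul, integral_neg, one_mul]
    at h1 h2
  rw [h2] at h1
  linear_combination -h1 / 2

lemma FlatGerm.balanced {T : Set ℂ} {u : ℂ} (h : FlatGerm T u) : Balanced T u := by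
  rcases h with h | ⟨X, hX, h⟩ | h
  · exact balanced_of_empty h
  · exact balanced_of_cone h hX Real.pi_pos le_rfl exp_pi_pow_four
  · exact balanced_of_univ h

/-! ### The square -/

lemma square_germ {l : ℝ} (hl : 0 < l) (u : ℂ) :
    FlatGerm (Set.Icc 0 l ×ℂ Set.Icc 0 l) u ∨ ∃ X : ℂ, ‖X‖ = 1 ∧
      HasGerm (Set.Icc 0 l ×ℂ Set.Icc 0 l) u (cone X (Real.pi / 2)) := by
  by_cases hu : u ∈ Set.Icc 0 l ×ℂ Set.Icc 0 l
  swap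
  · exact Or.inl (Or.inl (hasGerm_empty (isClosed_Icc.reProdIm isClosed_Icc) hu))
  obtain ⟨⟨u1, u2⟩, ⟨u3, u4⟩⟩ := hu
  have e1 : 0 < u.re → ∀ᶠ z in 𝓝 u, 0 < z.re := fun h =>
    continuous_re.continuousAt.eventually (lt_mem_nhds h)
  have e2 : u.re < l → ∀ᶠ z in 𝓝 u, z.re < l := fun h =>
    continuous_re.continuousAt.eventually (gt_mem_nhds h)
  have e3 : 0 < u.im → ∀ᶠ z in 𝓝 u, 0 < z.im := fun h =>
    continuous_im.continuousAt.eventually (lt_mem_nhds h)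
  have e4 : u.im < l → ∀ᶠ z in 𝓝 u, z.im < l := fun h =>
    continuous_im.continuousAt.eventually (gt_mem_nhds h)
  rcases u1.eq_or_lt with a1 | a1 <;> rcases u2.eq_or_lt with a2 | a2 <;>
    rcases u3.eq_or_lt with a3 | a3 <;> rcases u4.eq_or_lt with a4 | a4 <;>
    first | (exfalso; linarith) | skip
  · refine Or.inr ⟨1, by simp, ?_⟩
    filter_upwards [e2 a2, e4 a4] with z z2 z4
    simp [cone, mem_reProdIm, z2.le, z4.le, ← a1, ← a3, and_comm]
  · refine Or.inr ⟨-I, by simp, ?_⟩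
    filter_upwards [e2 a2, e3 a3] with z z2 z3
    simp [cone, mem_reProdIm, z2.le, z3.le, ← a1, a4, and_comm]
  · refine Or.inl (Or.inr (Or.inl ⟨-I, by simp, ?_⟩))
    filter_upwards [e2 a2, e3 a3, e4 a4] with z z2 z3 z4
    simp [cone, mem_reProdIm, z2.le, z3.le, z4.le, ← a1]
  · refine Or.inr ⟨I, by simp, ?_⟩
    filter_upwards [e1 a1, e4 a4] with z z2 z3
    simp [cone, mem_reProdIm, z2.le, z3.le, a2, ← a3, and_comm]
  · refine Or.inr ⟨-1, by simp, ?_⟩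
    filter_upwards [e1 a1, e3 a3] with z z2 z3
    simp [cone, mem_reProdIm, z2.le, z3.le, a2, a4, and_comm]
  · refine Or.inl (Or.inr (Or.inl ⟨I, by simp, ?_⟩))
    filter_upwards [e1 a1, e3 a3, e4 a4] with z z2 z3 z4
    simp [cone, mem_reProdIm, z2.le, z3.le, z4.le, a2]
  · refine Or.inl (Or.inr (Or.inl ⟨1, by simp, ?_⟩))
    filter_upwards [e1 a1, e2 a2, e4 a4] with z z2 z3 z4
    simp [cone, mem_reProdIm, z2.le, z3.le, z4.le, ← a3]
  · refine Or.inl (Or.inr (Or.inl ⟨-1, by simp, ?_⟩))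
    filter_upwards [e1 a1, e2 a2, e3 a3] with z z2 z3 z4
    simp [cone, mem_reProdIm, z2.le, z3.le, z4.le, a4]
  · refine Or.inl (Or.inr (Or.inr ?_))
    filter_upwards [e1 a1, e2 a2, e3 a3, e4 a4] with z z1 z2 z3 z4
    simp [mem_reProdIm, z1.le, z2.le, z3.le, z4.le]

lemma squareRegion_eq_image (q : ℂ) {s : ℂ} (hs : s ≠ 0) :
    ∃ f : ℂ ≃ᵢ ℂ, squareRegion q s = f '' (Set.Icc 0 ‖s‖ ×ℂ Set.Icc 0 ‖s‖) := by
  have hs0 : (‖s‖ : ℂ) ≠ 0 := ofReal_ne_zero.2 (norm_ne_zero_iff.2 hs)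
  obtain ⟨⟨f, hf⟩, -⟩ := exists_isometry q (s / ‖s‖) (by
    rw [norm_div, norm_real, norm_norm, div_self (norm_ne_zero_iff.2 hs)])
  refine ⟨f, ?_⟩
  have h1 : (Set.Icc 0 ‖s‖ ×ℂ Set.Icc 0 ‖s‖) = convexHull ℝ {0, (‖s‖ : ℂ), ‖s‖ + ‖s‖ * I, ‖s‖ * I} := by
    rw [← segment_eq_Icc (norm_nonneg s), ← convexHull_pair, ← convexHull_reProdIm]
    congr 1
    ext z
    simp only [mem_reProdIm, Set.mem_insert_iff, Set.mem_singleton_iff, Complex.ext_iff]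
    simp
    tauto
  have h2 := f.toRealAffineIsometryEquiv.toAffineEquiv.toAffineMap.image_convexHull
    {0, (‖s‖ : ℂ), ‖s‖ + ‖s‖ * I, ‖s‖ * I}
  have h3 : f '' convexHull ℝ {0, (‖s‖ : ℂ), ‖s‖ + ‖s‖ * I, ‖s‖ * I} =
      convexHull ℝ (f '' {0, (‖s‖ : ℂ), ‖s‖ + ‖s‖ * I, ‖s‖ * I}) := by
    simpa using h2
  rw [h1, h3, squareRegion]
  congr 1
  simp only [Set.image_insert_eq, Set.image_singleton, hf]
  have k2 : q + s / ‖s‖ * ‖s‖ = q + s := by field_simp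
  have k3 : q + s / ‖s‖ * (‖s‖ + ‖s‖ * I) = q + s + I * s := by field_simp; ring
  have k4 : q + s / ‖s‖ * (‖s‖ * I) = q + I * s := by field_simp
  rw [mul_zero, add_zero, k2, k3, k4]

/-- The square has only corners of opening `π / 2`, straight boundary points and interior points.
This is the only property of the square that the argument uses. -/
lemma balanced_squareRegion (q : ℂ) {s : ℂ} (hs : s ≠ 0) (u : ℂ) :
    Balanced (squareRegion q s) u := by
  obtain ⟨f, hf⟩ := squareRegion_eq_image q hs
  obtain ⟨y, rfl⟩ := f.surjective u
  rw [hf]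
  rcases square_germ (norm_pos_iff.2 hs) y with h | ⟨X, hX, h⟩
  · exact (h.image f).balanced
  · obtain ⟨X', hX', hc⟩ := exists_cone_map f y X hX (Real.pi / 2)
    exact balanced_of_cone (h.image f hc) hX' (by positivity) (by linarith [Real.pi_pos])
      exp_half_pi_pow_four

/-! ### Arcs of directions -/

lemma mem_openCone_exp {c t L ρ : ℝ} (hLπ : L < Real.pi) (h1 : c < t) (h2 : t < c + L)
    (hρ : 0 < ρ) : (ρ * exp (t * I) : ℂ) ∈ openCone (exp (c * I)) L := by
  have e : conj (exp (c * I)) * (ρ * exp (t * I)) = ρ * exp ((t - c : ℝ) * I) := by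
    rw [← exp_conj, map_mul, conj_I, conj_ofReal, mul_left_comm, ← exp_add]
    congr 2; push_cast; ring
  have s1 : 0 < Real.sin (t - c) := Real.sin_pos_of_pos_of_lt_pi (by linarith) (by linarith)
  have s2 : Real.sin (t - c - L) < 0 :=
    Real.sin_neg_of_neg_of_neg_pi_lt (by linarith) (by linarith)
  simp only [openCone, Set.mem_ofPred_eq, e, re_ofReal_mul, im_ofReal_mul, exp_ofReal_mul_I_re,
    exp_ofReal_mul_I_im]
  refine ⟨mul_pos hρ s1, ?_⟩
  rw [Real.sin_sub] at s2
  nlinarith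

lemma exists_angle_of_mem_openCone {c L : ℝ} {w : ℂ} (hL : 0 < L)
    (hw : w ∈ openCone (exp (c * I)) L) :
    ∃ t, c < t ∧ t < c + L ∧ w = ‖w‖ * exp (t * I) := by
  have hX : ‖exp (c * I)‖ = 1 := norm_exp_ofReal_mul_I c
  obtain ⟨h1, h2⟩ := hw
  set v := conj (exp (c * I)) * w with hv
  have hvw : w = exp (c * I) * v := by
    rw [hv]; linear_combination -w * conj_mul_self_of_norm hX
  have hn : ‖v‖ = ‖w‖ := by
    rw [hv, norm_mul, RCLike.norm_conj, hX, one_mul]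
  have hv0 : 0 < ‖v‖ := norm_pos_iff.2 fun h => by rw [h] at h1; simp at h1
  have him : v.im = ‖v‖ * Real.sin v.arg := (norm_mul_sin_arg v).symm
  have hre : v.re = ‖v‖ * Real.cos v.arg := (norm_mul_cos_arg v).symm
  have s1 : 0 < Real.sin v.arg := by
    rw [him] at h1; exact pos_of_mul_pos_right h1 hv0.le
  have s2 : Real.sin (v.arg - L) < 0 := by
    rw [Real.sin_sub]
    rw [him, hre] at h2
    by_contra! hc
    nlinarith [mul_nonneg hv0.le hc]
  refine ⟨c + v.arg, ?_, ?_, ?_⟩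
  · have : 0 < v.arg := by
      by_contra! hc
      linarith [Real.sin_nonpos_of_nonpos_of_neg_pi_le hc (neg_pi_lt_arg v).le]
    linarith
  · have : v.arg < L := by
      by_contra! hc
      linarith [Real.sin_nonneg_of_nonneg_of_le_pi (sub_nonneg.2 hc) (by linarith [arg_le_pi v])]
    linarith
  · rw [← hn, ofReal_add, add_mul, exp_add, mul_left_comm, norm_mul_exp_arg_mul_I, ← hvw]

lemma exp_add_int_mul (c : ℝ) (n : ℤ) : exp ((c + n * (2 * Real.pi) : ℝ) * I) = exp (c * I) :=
  exp_eq_exp_iff_exists_int.2 ⟨n, by push_cast; ring⟩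

lemma exp_sub_pi (c : ℝ) : exp ((c - Real.pi : ℝ) * I) = -exp (c * I) := by
  rw [ofReal_sub, sub_mul, exp_sub, exp_pi_mul_I, div_neg, div_one]

/-- The half-open window of length `2π` makes it possible to place all arcs at a vertex within one
turn below a reference argument `c`. -/
lemma exists_lift {X : ℂ} (hX : ‖X‖ = 1) (c : ℝ) :
    ∃ c', c - 2 * Real.pi < c' ∧ c' ≤ c ∧ X = exp (c' * I) := by
  have h := toIocMod_mem_Ioc Real.two_pi_pos (c - 2 * Real.pi) X.arg
  rw [sub_add_cancel] at h
  refine ⟨_, h.1, h.2, ?_⟩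
  have h1 : X = exp (X.arg * I) := by
    have := norm_mul_exp_arg_mul_I X
    rw [hX, ofReal_one, one_mul] at this
    exact this.symm
  have h2 : toIocMod Real.two_pi_pos (c - 2 * Real.pi) X.arg =
      X.arg + (-toIocDiv Real.two_pi_pos (c - 2 * Real.pi) X.arg : ℤ) * (2 * Real.pi) := by
    rw [toIocMod]; simp [sub_eq_add_neg]
  rw [h2, exp_add_int_mul]
  exact h1

/-- Among the arguments of `X`, the one whose arc contains the prescribed `t` is selected. Thus the
parameters ordering an angle pattern and the arcs of the tiles can be compared on one real line. -/
lemma exists_lift_of_angle {X w : ℂ} {L t : ℝ} (hX : ‖X‖ = 1) (hL : 0 < L)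
    (hw : w ∈ openCone X L) (ht : w = ‖w‖ * exp (t * I)) :
    ∃ c : ℝ, X = exp (c * I) ∧ c < t ∧ t < c + L := by
  obtain ⟨c, -, -, rfl⟩ := exists_lift hX 0
  obtain ⟨t', h1, h2, h3⟩ := exists_angle_of_mem_openCone hL hw
  have hw0 : (‖w‖ : ℂ) ≠ 0 := by
    rw [ofReal_ne_zero, norm_ne_zero_iff]
    rintro rfl
    simp [openCone] at hw
  have h4 : exp (t * I) = exp (t' * I) := mul_left_cancel₀ hw0 (ht.symm.trans h3)
  obtain ⟨n, hn⟩ := exp_eq_exp_iff_exists_int.1 h4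
  have h5 : t = t' + n * (2 * Real.pi) := by
    have : (t : ℂ) * I = ((t' + n * (2 * Real.pi) : ℝ) : ℂ) * I := by rw [hn]; push_cast; ring
    exact_mod_cast mul_right_cancel₀ I_ne_zero this
  exact ⟨c + n * (2 * Real.pi), (exp_add_int_mul c n).symm, by linarith, by linarith⟩

lemma isOpen_openCone (X : ℂ) (L : ℝ) : IsOpen (openCone X L) := by
  unfold openCone
  refine IsOpen.and ?_ ?_
  · exact isOpen_lt (by fun_prop) (by fun_prop)
  · exact isOpen_lt (by fun_prop) (by fun_prop)

lemma HasGerm.eventually_interior {T : Set ℂ} {u X : ℂ} {L : ℝ} (h : HasGerm T u (cone X L)) :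
    ∀ᶠ z in 𝓝 u, z - u ∈ openCone X L → z ∈ interior T := by
  filter_upwards [h.eventually_nhds] with z hz hzo
  rw [mem_interior_iff_mem_nhds]
  have h1 : ∀ᶠ y in 𝓝 z, y - u ∈ openCone X L :=
    (continuous_id.sub continuous_const).continuousAt.eventually
      ((isOpen_openCone X L).mem_nhds hzo)
  filter_upwards [hz, h1] with y hy hyo
  exact hy.2 ⟨hyo.1.le, hyo.2.le⟩

/-- The arcs of directions of two non-overlapping tiles at a common vertex are disjoint. -/
lemma arcs_disjoint {T T' : Set ℂ} {u : ℂ} {c c' L L' : ℝ} (hT : HasGerm T u (cone (exp (c * I)) L))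
    (hT' : HasGerm T' u (cone (exp (c' * I)) L')) (hd : Disjoint (interior T) (interior T'))
    (hL : 0 < L) (hLπ : L < Real.pi) (hL' : 0 < L') (hLπ' : L' < Real.pi) :
    c + L ≤ c' ∨ c' + L' ≤ c := by
  by_contra! hc
  obtain ⟨t, h1, h2⟩ : ∃ t, max c c' < t ∧ t < min (c + L) (c' + L') :=
    exists_between (max_lt (lt_min (by linarith) hc.2) (lt_min hc.1 (by linarith)))
  rw [max_lt_iff] at h1
  rw [lt_min_iff] at h2
  have hlim : Tendsto (fun ρ : ℝ => u + ρ * exp (t * I)) (𝓝[>] 0) (𝓝 u) := by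
    have : Continuous fun ρ : ℝ => u + ρ * exp (t * I) := by fun_prop
    have h := this.tendsto 0
    simp only [ofReal_zero, zero_mul, add_zero] at h
    exact h.mono_left nhdsWithin_le_nhds
  obtain ⟨ρ, hρ1, hρ2, hρ⟩ := ((hlim.eventually hT.eventually_interior).and
    ((hlim.eventually hT'.eventually_interior).and self_mem_nhdsWithin)).exists
  rw [add_sub_cancel_left] at hρ1 hρ2
  exact Set.disjoint_left.1 hd (hρ1 (mem_openCone_exp hLπ h1.1 h2.1 hρ))
    (hρ2 (mem_openCone_exp hLπ' h1.2 h2.2 hρ))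

/-! ### Additivity of integrals over a tiling -/

lemma convex_image_isometry (f : ℂ ≃ᵢ ℂ) {P : Set ℂ} (hP : Convex ℝ P) : Convex ℝ (f '' P) := by
  have := hP.affine_image f.toRealAffineIsometryEquiv.toAffineEquiv.toAffineMap
  simpa using this

/-- Tiles with disjoint interiors can meet only in points of their frontiers, and the frontier of a
convex set is null. -/
lemma IsTiling.setIntegral_inter_ball {E : Type*} [NormedAddCommGroup E] [NormedSpace ℝ E]
    {Ω P : Set ℂ} {N : ℕ} {φ : Fin N → ℂ ≃ᵢ ℂ} (h : IsTiling Ω P φ) (hP : Convex ℝ P)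
    {g : ℂ → E} (hg : Continuous g) (u : ℂ) (r : ℝ) :
    ∫ z in Ω ∩ Metric.ball u r, g z = ∑ j, ∫ z in φ j '' P ∩ Metric.ball u r, g z := by
  have hc : ∀ j, Convex ℝ (φ j '' P) := fun j => convex_image_isometry (φ j) hP
  rw [h.cover, Set.iUnion_inter, integral_iUnion_ae, tsum_fintype]
  · exact fun j => ((hc j).nullMeasurableSet volume).inter measurableSet_ball.nullMeasurableSet
  · intro i j hij
    have hsub : (φ i '' P ∩ Metric.ball u r) ∩ (φ j '' P ∩ Metric.ball u r) ⊆
        frontier (φ i '' P) ∪ frontier (φ j '' P) := by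
      rintro z ⟨⟨h1, -⟩, ⟨h2, -⟩⟩
      by_contra hz
      rw [Set.mem_union, not_or] at hz
      have hd := Set.disjoint_left.1 (h.interiors_disjoint hij)
      refine @hd z ?_ ?_
      · by_contra h3; exact hz.1 ⟨subset_closure h1, h3⟩
      · by_contra h3; exact hz.2 ⟨subset_closure h2, h3⟩
    exact measure_mono_null hsub
      (measure_union_null ((hc i).addHaar_frontier volume) ((hc j).addHaar_frontier volume))
  · refine (hg.continuousOn.integrableOn_compact (isCompact_closedBall u r)).mono_set ?_
    exact Set.iUnion_subset fun j => Set.inter_subset_right.trans Metric.ball_subset_closedBall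

lemma IsTiling.sum_area_le {Ω P : Set ℂ} {N : ℕ} {φ : Fin N → ℂ ≃ᵢ ℂ} (h : IsTiling Ω P φ)
    (hP : Convex ℝ P) (u : ℂ) {r : ℝ} (hr : 0 ≤ r) :
    ∑ j, volume.real (φ j '' P ∩ Metric.ball u r) ≤ Real.pi * r ^ 2 := by
  have h1 := h.setIntegral_inter_ball hP (g := fun _ => (1 : ℝ)) continuous_const u r
  simp only [setIntegral_const, smul_eq_mul, mul_one] at h1
  rw [← h1]
  have h2 : volume.real (Metric.ball u r) = Real.pi * r ^ 2 := by
    rw [Measure.real, Complex.volume_ball]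
    simp [hr, mul_comm]
  rw [← h2]
  exact measureReal_mono Set.inter_subset_right measure_ball_lt_top.ne

/-! ### Relations between the directions of the tiles at a vertex -/

lemma IsRightTrapezoid.index_of_angle {α : ℝ} {p : Fin 4 → ℂ} (hp : IsRightTrapezoid α p)
    (i : Fin 4) : (vertexAngle p i = α → i = 0) ∧ (vertexAngle p i = Real.pi - α → i = 1) := by
  have h1 := hp.pos
  have h2 := hp.lt
  match i with
  | 0 => rw [hp.angle_a]; exact ⟨fun _ => rfl, fun h => by linarith⟩
  | 1 => rw [hp.angle_b]; exact ⟨fun h => by linarith, fun _ => rfl⟩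
  | 2 => rw [hp.angle_c]; exact ⟨fun h => by linarith, fun h => by linarith⟩
  | 3 => rw [hp.angle_d]; exact ⟨fun h => by linarith, fun h => by linarith⟩

/-- The number `4 * α` lies strictly between `0` and `2π`. Without this, the fourth-power integrals
would not see the angle `α` either. -/
lemma exp_pow_four_ne_one {α : ℝ} (h0 : 0 < α) (h1 : α < Real.pi / 2) : exp (α * I) ^ 4 ≠ 1 := by
  intro h
  rw [← exp_nat_mul, exp_eq_one_iff] at h
  obtain ⟨n, hn⟩ := h
  have h2 : 4 * α = n * (2 * Real.pi) := by
    have : ((4 * α : ℝ) : ℂ) * I = ((n * (2 * Real.pi) : ℝ) : ℂ) * I := by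
      push_cast at hn ⊢; linear_combination hn
    exact_mod_cast mul_right_cancel₀ I_ne_zero this
  have h3 : (0 : ℝ) < n := by
    by_contra! hc
    nlinarith [Real.pi_pos]
  have h4 : (n : ℝ) < 1 := by
    by_contra! hc
    nlinarith [Real.pi_pos]
  have h5 : 0 < n := by exact_mod_cast h3
  have h6 : n < 1 := by exact_mod_cast h4
  omega

/-- A tiling by trapezoids of a region at all of whose points `∫ (z - u) ^ 4` over small discs
vanishes, with the local data of the tiles. -/
structure FramedTiling (α : ℝ) (p : Fin 4 → ℂ) (Ω : Set ℂ) {N : ℕ} (φ : Fin N → ℂ ≃ᵢ ℂ)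
    (X Y : Fin N → ℂ) : Prop where
  trapezoid : IsRightTrapezoid α p
  tiling : IsTiling Ω (region p) φ
  balanced : ∀ u, Balanced Ω u
  frame : ∀ j, IsTileFrame α (φ j '' region p) (fun i => φ j (p i)) (tileCenter p φ j) (X j) (Y j)

section

variable {α : ℝ} {p : Fin 4 → ℂ} {Ω : Set ℂ} {N : ℕ} {φ : Fin N → ℂ ≃ᵢ ℂ} {X Y : Fin N → ℂ}

lemma IsTileFrame.exp_mul_pow {T : Set ℂ} {v : Fin 4 → ℂ} {m x y : ℂ}
    (h : IsTileFrame α T v m x y) : (y * exp ((Real.pi - α : ℝ) * I)) ^ 4 = x ^ 4 := by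
  rcases h.dir with h | h <;> rw [h]
  ring

namespace FramedTiling

variable (h : FramedTiling α p Ω φ X Y)
include h

lemma eq_of_vertex_eq {j : Fin N} {i i' : Fin 4} (hi : φ j (p i) = φ j (p i')) : i = i' :=
  vertex_injective h.trapezoid ((φ j).injective hi)

open Classical in
/-- The angles at a point add up to at most `2π`. -/
lemma angle_sum_le (u : ℂ) :
    ∑ j, ((if φ j (p 0) = u then α else 0) + (if φ j (p 1) = u then Real.pi - α else 0) +
      (if φ j (p 2) = u ∨ φ j (p 3) = u then Real.pi / 2 else 0)) ≤ 2 * Real.pi := by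
  have h0 := h.trapezoid.pos
  have h1 := h.trapezoid.lt
  have hne : ∀ {j : Fin N} {i i' : Fin 4}, i ≠ i' → φ j (p i) = u → φ j (p i') ≠ u :=
    fun hii h3 h4 => hii (h.eq_of_vertex_eq (h3.trans h4.symm))
  have key : ∀ j, ∀ᶠ r in 𝓝[>] (0 : ℝ),
      ((if φ j (p 0) = u then α else 0) + (if φ j (p 1) = u then Real.pi - α else 0) +
      (if φ j (p 2) = u ∨ φ j (p 3) = u then Real.pi / 2 else 0)) * (r ^ 2 / 2) ≤
        volume.real (φ j '' region p ∩ Metric.ball u r) := by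
    intro j
    by_cases ha : φ j (p 0) = u
    · have hg := (h.frame j).germ_a
      simp only [ha] at hg
      filter_upwards [hg.area (h.frame j).norm_X h0 (by linarith)] with r hr
      simp [ha, hne (show (0 : Fin 4) ≠ 1 by decide) ha, hne (show (0 : Fin 4) ≠ 2 by decide) ha,
        hne (show (0 : Fin 4) ≠ 3 by decide) ha, hr]
    · by_cases hb : φ j (p 1) = u
      · have hg := (h.frame j).germ_b
        simp only [hb] at hg
        filter_upwards [hg.area (h.frame j).norm_Y (by linarith) (by linarith)] with r hr
        simp [ha, hb, hne (show (1 : Fin 4) ≠ 2 by decide) hb,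
          hne (show (1 : Fin 4) ≠ 3 by decide) hb, hr]
      · by_cases hc : φ j (p 2) = u ∨ φ j (p 3) = u
        · obtain ⟨Z, hZ, hg⟩ := (h.frame j).germ_right u (hc.imp Eq.symm Eq.symm)
          filter_upwards [hg.area hZ (by positivity) (by linarith)] with r hr
          simp [ha, hb, hc, hr]
        · filter_upwards with r
          simp [ha, hb, hc]
  obtain ⟨r, hr, hr0⟩ := ((eventually_all.2 key).and self_mem_nhdsWithin).exists
  have hr0 : 0 < r := hr0
  have h2 := (Finset.sum_le_sum fun j _ => hr j).trans
    (h.tiling.sum_area_le (convex_convexHull _ _) u hr0.le)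
  rw [← Finset.sum_mul] at h2
  have h3 : 0 < r ^ 2 / 2 := by positivity
  refine le_of_mul_le_mul_right (h2.trans_eq ?_) h3
  ring

open Classical in
/-- The fourth powers of the directions of the tiles with angle `α` at `u` and of those with angle
`π - α` at `u` have the same sum. -/
lemma sum_pow_four (u : ℂ) :
    ∑ j, (if φ j (p 0) = u then X j ^ 4 else 0) = ∑ j, (if φ j (p 1) = u then X j ^ 4 else 0) := by
  have h0 := h.trapezoid.pos
  have h1 := h.trapezoid.lt
  have hne : ∀ {j : Fin N} {i i' : Fin 4}, i ≠ i' → φ j (p i) = u → φ j (p i') ≠ u :=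
    fun hii h3 h4 => hii (h.eq_of_vertex_eq (h3.trans h4.symm))
  have hω : exp ((Real.pi - α : ℝ) * I) ^ 4 * exp (α * I) ^ 4 = 1 := by
    rw [exp_pi_sub, ← mul_pow, neg_mul, conj_mul_self_of_norm (norm_exp_ofReal_mul_I α)]
    norm_num
  -- An angle `π - α` contributes `Y ^ 4 * (ω⁻⁴ - 1) = -(Y * ω⁻¹) ^ 4 * (ω ^ 4 - 1)`, and `(Y * ω⁻¹)
  -- ^ 4 = X ^ 4` because the counterclockwise side at `b` is parallel to `X`. It is thus the
  -- opposite of what an angle `α` with the same `X` contributes.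
  have key : ∀ j, ∀ᶠ r in 𝓝[>] (0 : ℝ),
      ∫ z in φ j '' region p ∩ Metric.ball u r, (z - u) ^ 4 =
        ((∫ ρ in (0 : ℝ)..r, (ρ : ℂ) ^ 5) / (4 * I) * (exp (α * I) ^ 4 - 1)) *
        ((if φ j (p 0) = u then X j ^ 4 else 0) - (if φ j (p 1) = u then X j ^ 4 else 0)) := by
    intro j
    by_cases ha : φ j (p 0) = u
    · have hg := (h.frame j).germ_a
      simp only [ha] at hg
      filter_upwards [hg.integral_pow_four (h.frame j).norm_X h0 (by linarith)] with r hr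
      rw [hr, if_pos ha, if_neg (hne (by decide) ha)]
      ring
    · by_cases hb : φ j (p 1) = u
      · have hg := (h.frame j).germ_b
        simp only [hb] at hg
        filter_upwards [hg.integral_pow_four (h.frame j).norm_Y (by linarith) (by linarith)]
          with r hr
        have hx := (h.frame j).exp_mul_pow
        rw [mul_pow] at hx
        rw [hr, if_neg ha, if_pos hb]
        linear_combination ((∫ ρ in (0 : ℝ)..r, (ρ : ℂ) ^ 5) / (4 * I)) *
          (hx - exp (α * I) ^ 4 * hx + Y j ^ 4 * hω)
      · have : Balanced (φ j '' region p) u := by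
          by_cases hc : φ j (p 2) = u ∨ φ j (p 3) = u
          · obtain ⟨Z, hZ, hg⟩ := (h.frame j).germ_right u (hc.imp Eq.symm Eq.symm)
            exact balanced_of_cone hg hZ (by positivity) (by linarith) exp_half_pi_pow_four
          · rw [not_or] at hc
            refine ((h.frame j).germ_flat u fun i hi => ?_).balanced
            match i with
            | 0 => exact ha hi.symm
            | 1 => exact hb hi.symm
            | 2 => exact hc.1 hi.symm
            | 3 => exact hc.2 hi.symm
        filter_upwards [this] with r hr
        rw [hr, if_neg ha, if_neg hb]
        ring
  obtain ⟨r, hr, hΩ, hr0⟩ :=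
    ((eventually_all.2 key).and ((h.balanced u).and self_mem_nhdsWithin)).exists
  have h2 := h.tiling.setIntegral_inter_ball (convex_convexHull _ _)
    (g := fun z => (z - u) ^ 4) (by fun_prop) u r
  have h3 : ∑ j, ∫ z in φ j '' region p ∩ Metric.ball u r, (z - u) ^ 4 = _ :=
    Finset.sum_congr rfl fun j _ => hr j
  rw [hΩ, h3, ← Finset.mul_sum, Finset.sum_sub_distrib] at h2
  have h4 := mul_ne_zero (radial_integral_ne_zero hr0) (sub_ne_zero.2 (exp_pow_four_ne_one h0 h1))
  exact sub_eq_zero.1 ((mul_eq_zero.1 h2.symm).resolve_left h4)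

/-- The separation of two angles at a common vertex of two tiles. -/
lemma separated {u : ℂ} {j j' : Fin N} (hj : j ≠ j') {c c' L L' : ℝ}
    (hg : HasGerm (φ j '' region p) u (cone (exp (c * I)) L))
    (hg' : HasGerm (φ j' '' region p) u (cone (exp (c' * I)) L'))
    (hL : L = α ∨ L = Real.pi - α) (hL' : L' = α ∨ L' = Real.pi - α) :
    c + L ≤ c' ∨ c' + L' ≤ c := by
  have h0 := h.trapezoid.pos
  have h1 := h.trapezoid.lt
  refine arcs_disjoint hg hg' (h.tiling.interiors_disjoint hj) ?_ ?_ ?_ ?_ <;>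
    rcases hL with rfl | rfl <;> rcases hL' with rfl | rfl <;> linarith

lemma germ_a {u : ℂ} {j : Fin N} (hj : φ j (p 0) = u) :
    HasGerm (φ j '' region p) u (cone (X j) α) := by
  have := (h.frame j).germ_a
  simpa only [hj] using this

lemma germ_b {u : ℂ} {j : Fin N} (hj : φ j (p 1) = u) :
    HasGerm (φ j '' region p) u (cone (Y j) (Real.pi - α)) := by
  have := (h.frame j).germ_b
  simpa only [hj] using this

lemma pow_four_of_dir {j : Fin N} {c : ℝ} (hc : Y j = exp (c * I)) :
    X j ^ 4 = exp ((c + (Real.pi - α) : ℝ) * I) ^ 4 := by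
  rw [← (h.frame j).exp_mul_pow, hc, ← exp_add]
  congr 2
  push_cast; ring

/-- The tiles of an angle pattern `(α, α, π - α, π - α)`: the indices of their vertices. -/
lemma pattern_vertices {u : ℂ} {x : Fin 4 → Fin N × Fin 4}
    (hx : IsAnglePattern p φ u x ![α, α, Real.pi - α, Real.pi - α]) :
    ((x 0).2 = 0 ∧ (x 1).2 = 0 ∧ (x 2).2 = 1 ∧ (x 3).2 = 1) ∧
      (∀ n, φ (x n).1 (p (x n).2) = u) ∧ ∀ n m, n ≠ m → (x n).1 ≠ (x m).1 := by
  have hang : ∀ n, vertexAngle p (x n).2 = ![α, α, Real.pi - α, Real.pi - α] n := fun n => by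
    rw [← hx.angle_eq n, vertexAngle_isometry]
  have hi0 := (h.trapezoid.index_of_angle (x 0).2).1 (hang 0)
  have hi1 := (h.trapezoid.index_of_angle (x 1).2).1 (hang 1)
  have hi2 := (h.trapezoid.index_of_angle (x 2).2).2 (hang 2)
  have hi3 := (h.trapezoid.index_of_angle (x 3).2).2 (hang 3)
  have hu : ∀ n, φ (x n).1 (p (x n).2) = u := fun n => by
    have : x n ∈ Set.range x := ⟨n, rfl⟩
    rwa [hx.range_eq] at this
  have hne : ∀ n m, n ≠ m → (x n).1 ≠ (x m).1 := fun n m hnm h2 => by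
    refine hnm (hx.injective (Prod.ext h2 ?_))
    have h3 := hu n
    rw [h2, ← hu m] at h3
    exact h.eq_of_vertex_eq h3
  exact ⟨⟨hi0, hi1, hi2, hi3⟩, hu, hne⟩

/-- At a vertex with angle pattern `(α, α, π - α, π - α)`, paired edges belong to tiles with the
same direction up to a power of `i`. -/
lemma pow_four_eq_of_paired {u : ℂ} {e f : Fin N} (hp : Paired p φ α u e f) :
    X e ^ 4 = X f ^ 4 := by
  obtain ⟨x, hx, hef⟩ := hp
  have h0 := h.trapezoid.pos
  have h1 := h.trapezoid.lt
  obtain ⟨⟨hi0, hi1, hi2, hi3⟩, hu, hne⟩ := h.pattern_vertices hx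
  obtain ⟨t, ht, ht2, htc⟩ := hx.clockwise
  have hu0 := hu 0
  have hu1 := hu 1
  have hu2 := hu 2
  have hu3 := hu 3
  rw [hi0] at hu0
  rw [hi1] at hu1
  rw [hi2] at hu2
  rw [hi3] at hu3
  have ca : ∀ {j : Fin N} (n : Fin 4), φ j (p 0) = u → j = (x n).1 →
      ∃ c : ℝ, X j = exp (c * I) ∧ c < t n ∧ t n < c + α := fun {j} n hj hjn => by
    have hc := (h.frame j).center_a
    simp only [hj] at hc
    rw [hjn] at hc ⊢
    exact exists_lift_of_angle (h.frame _).norm_X (by linarith) hc (htc n).2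
  have cb : ∀ {j : Fin N} (n : Fin 4), φ j (p 1) = u → j = (x n).1 →
      ∃ c : ℝ, Y j = exp (c * I) ∧ c < t n ∧ t n < c + (Real.pi - α) := fun {j} n hj hjn => by
    have hc := (h.frame j).center_b
    simp only [hj] at hc
    rw [hjn] at hc ⊢
    exact exists_lift_of_angle (h.frame _).norm_Y (by linarith) hc (htc n).2
  obtain ⟨c0, hc0, k0, l0⟩ := ca 0 hu0 rfl
  obtain ⟨c1, hc1, k1, l1⟩ := ca 1 hu1 rfl
  obtain ⟨c2, hc2, k2, l2⟩ := cb 2 hu2 rfl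
  obtain ⟨c3, hc3, k3, l3⟩ := cb 3 hu3 rfl
  have g0 := h.germ_a hu0
  have g1 := h.germ_a hu1
  have g2 := h.germ_b hu2
  have g3 := h.germ_b hu3
  have g0' := g0
  -- The same direction one turn lower, to compare the last arc with the first one across the end of
  -- the turn.
  have hc0' : X (x 0).1 = exp ((c0 + (-1 : ℤ) * (2 * Real.pi) : ℝ) * I) := by
    rw [exp_add_int_mul, hc0]
  rw [hc0'] at g0'
  rw [hc0] at g0
  rw [hc1] at g1
  rw [hc2] at g2
  rw [hc3] at g3
  have t01 : t 1 < t 0 := ht (by decide)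
  have t12 : t 2 < t 1 := ht (by decide)
  have t23 : t 3 < t 2 := ht (by decide)
  have t30 : t 0 - t 3 < 2 * Real.pi := ht2 0 3
  -- The four openings add up to exactly `2π`, so these four cyclic inequalities are equalities: the
  -- arcs abut. Hence the counterclockwise side of `L_β` is opposite to the clockwise side of `L_α`,
  -- and that of `R_β` coincides with the clockwise side of `R_α`.
  have s01 : c1 + α ≤ c0 := by
    rcases h.separated (hne 0 1 (by decide)) g0 g1 (Or.inl rfl) (Or.inl rfl) with h | h <;> linarith
  have s12 : c2 + (Real.pi - α) ≤ c1 := by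
    rcases h.separated (hne 1 2 (by decide)) g1 g2 (Or.inl rfl) (Or.inr rfl) with h | h <;> linarith
  have s23 : c3 + (Real.pi - α) ≤ c2 := by
    rcases h.separated (hne 2 3 (by decide)) g2 g3 (Or.inr rfl) (Or.inr rfl) with h | h <;> linarith
  have s30 : c0 - 2 * Real.pi + α ≤ c3 := by
    rcases h.separated (hne 0 3 (by decide)) g0' g3 (Or.inl rfl) (Or.inr rfl) with h | h <;>
      push_cast at h <;> linarith
  rcases hef with ⟨rfl, rfl⟩ | ⟨rfl, rfl⟩
  · rw [h.pow_four_of_dir hc3, hc0, show c3 + (Real.pi - α) = c0 - Real.pi by linarith, exp_sub_pi]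
    ring
  · rw [h.pow_four_of_dir hc2, hc1]
    congr 4
    linarith

/-- Four tiles whose angles `α, α, π - α, π - α` follow one another clockwise around `u` and which
are all the tiles with vertex `u` form the pattern defining `aabbVertices`. -/
lemma mem_aabbVertices {u : ℂ} {a a' b b' : Fin N} (haa : a ≠ a') (hbb : b ≠ b')
    (ha : ∀ j, φ j (p 0) = u ↔ j = a ∨ j = a') (hb : ∀ j, φ j (p 1) = u ↔ j = b ∨ j = b')
    (hc : ∀ j, φ j (p 2) ≠ u ∧ φ j (p 3) ≠ u) {c : ℝ} (hca : X a = exp ((c : ℝ) * I))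
    (hca' : X a' = exp ((c - α : ℝ) * I)) (hcb : Y b = exp ((c - Real.pi : ℝ) * I))
    (hcb' : Y b' = exp ((c + α - 2 * Real.pi : ℝ) * I)) : u ∈ aabbVertices p φ α := by
  have h0 := h.trapezoid.pos
  have h1 := h.trapezoid.lt
  have hua := (ha a).2 (Or.inl rfl)
  have hua' := (ha a').2 (Or.inr rfl)
  have hub := (hb b).2 (Or.inl rfl)
  have hub' := (hb b').2 (Or.inr rfl)
  have key : ∀ (j : Fin N) (i : Fin 4) (Z : ℂ) (L c' : ℝ), φ j (p i) = u → 0 < L →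
      tileCenter p φ j - φ j (p i) ∈ openCone Z L → Z = exp (c' * I) →
      ∃ t, c' < t ∧ t < c' + L ∧ tileCenter p φ j ≠ u ∧
        tileCenter p φ j - u = (‖tileCenter p φ j - u‖ : ℂ) * exp (t * I) := by
    rintro j i Z L c' rfl hL hcen rfl
    obtain ⟨t, h2, h3, h4⟩ := exists_angle_of_mem_openCone hL hcen
    refine ⟨t, h2, h3, fun h5 => ?_, h4⟩
    rw [h5, sub_self] at hcen
    simp [openCone] at hcen
  obtain ⟨t0, k0, l0, m0⟩ := key a 0 _ _ _ hua (by linarith) (h.frame a).center_a hca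
  obtain ⟨t1, k1, l1, m1⟩ := key a' 0 _ _ _ hua' (by linarith) (h.frame a').center_a hca'
  obtain ⟨t2, k2, l2, m2⟩ :=
    key b 1 _ _ _ hub (by linarith) (h.frame b).center_b hcb
  obtain ⟨t3, k3, l3, m3⟩ :=
    key b' 1 _ _ _ hub' (by linarith) (h.frame b').center_b hcb'
  refine ⟨Set.mem_iUnion.2 ⟨a, Or.inl hua.symm⟩, ![(a, 0), (a', 0), (b, 1), (b', 1)], ?_, ?_, ?_, ?_⟩
  · intro n m hnm
    fin_cases n <;> fin_cases m <;> simp_all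
  · ext ⟨j, i⟩
    simp only [Matrix.range_cons, Matrix.range_empty, Set.union_empty, Set.mem_union,
      Set.mem_singleton_iff, Prod.mk.injEq, Set.mem_ofPred_eq]
    match i with
    | 0 => simp [ha]
    | 1 => simp [hb]
    | 2 => simp [(hc j).1]
    | 3 => simp [(hc j).2]
  · refine ⟨![t0, t1, t2, t3], ?_, ?_, ?_⟩
    · intro n m hnm
      fin_cases n <;> fin_cases m <;> simp at hnm ⊢ <;> linarith
    · intro n m
      fin_cases n <;> fin_cases m <;> simp <;> linarith
    · intro n
      fin_cases n
      exacts [m0, m1, m2, m3]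
  · intro n
    rw [vertexAngle_isometry]
    fin_cases n
    exacts [h.trapezoid.angle_a, h.trapezoid.angle_a, h.trapezoid.angle_b, h.trapezoid.angle_b]

/-- At a vertex outside `aabbVertices` with as many incoming as outgoing edges, all tiles with an
edge at that vertex have the same direction up to a power of `i`. -/
lemma pow_four_eq_of_notMem {u : ℂ} (hu : u ∉ aabbVertices p φ α)
    (hcard : Nat.card {j // φ j (p 1) = u} = Nat.card {j // φ j (p 0) = u}) {e f : Fin N}
    (he : φ e (p 1) = u) (hf : φ f (p 0) = u) : X e ^ 4 = X f ^ 4 := by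
  classical
  have h0 := h.trapezoid.pos
  have h1 := h.trapezoid.lt
  have hpi := Real.pi_pos
  rw [Nat.card_eq_fintype_card, Nat.card_eq_fintype_card, Fintype.card_subtype,
    Fintype.card_subtype] at hcard
  have hsum := h.angle_sum_le u
  have hpow := h.sum_pow_four u
  rw [Finset.sum_add_distrib, Finset.sum_add_distrib, ← Finset.sum_filter, ← Finset.sum_filter,
    ← Finset.sum_filter] at hsum
  simp only [Finset.sum_const, nsmul_eq_mul] at hsum
  rw [← Finset.sum_filter, ← Finset.sum_filter] at hpow
  set S := Finset.univ.filter fun j => φ j (p 0) = u with hS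
  set R := Finset.univ.filter fun j => φ j (p 1) = u with hR
  set Q := Finset.univ.filter fun j => φ j (p 2) = u ∨ φ j (p 3) = u with hQ
  have heR : e ∈ R := by simp [hR, he]
  have hfS : f ∈ S := by simp [hS, hf]
  rw [hcard] at hsum
  have hk0 : 0 < S.card := Finset.card_pos.2 ⟨f, hfS⟩
  have hQ0 : (0 : ℝ) ≤ Q.card := Nat.cast_nonneg _
  -- Each outgoing edge together with an incoming one takes up `α + (π - α) = π` of the full turn.
  have hk2 : S.card ≤ 2 := by
    have : (S.card : ℝ) ≤ 2 := by
      by_contra! hc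
      nlinarith
    exact_mod_cast this
  obtain hk | hk : S.card = 1 ∨ S.card = 2 := by omega
  · obtain ⟨f', hf'⟩ := Finset.card_eq_one.1 hk
    obtain ⟨e', he'⟩ := Finset.card_eq_one.1 (hcard.trans hk)
    rw [hf'] at hfS hpow
    rw [he'] at heR hpow
    rw [Finset.sum_singleton, Finset.sum_singleton] at hpow
    rw [Finset.mem_singleton.1 hfS, Finset.mem_singleton.1 heR, hpow]
  -- The two pairs already fill the full turn, which leaves no room for a right angle.
  · have hQc : Q.card = 0 := by
      by_contra hc
      have : (1 : ℝ) ≤ Q.card := by exact_mod_cast Nat.one_le_iff_ne_zero.2 hc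
      rw [hk] at hsum
      push_cast at hsum
      nlinarith
    have hc : ∀ j, φ j (p 2) ≠ u ∧ φ j (p 3) ≠ u := fun j => by
      have : j ∉ Q := by rw [Finset.card_eq_zero.1 hQc]; simp
      simpa [hQ, not_or] using this
    obtain ⟨a, a', haa, haS⟩ := Finset.card_eq_two.1 hk
    obtain ⟨b, b', hbb, hbR⟩ := Finset.card_eq_two.1 (hcard.trans hk)
    have ha : ∀ j, φ j (p 0) = u ↔ j = a ∨ j = a' := fun j => by
      have : j ∈ S ↔ j = a ∨ j = a' := by rw [haS]; simp
      rw [← this]; simp [hS]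
    have hb : ∀ j, φ j (p 1) = u ↔ j = b ∨ j = b' := fun j => by
      have : j ∈ R ↔ j = b ∨ j = b' := by rw [hbR]; simp
      rw [← this]; simp [hR]
    have hab : ∀ {j j'}, φ j (p 0) = u → φ j' (p 1) = u → j ≠ j' := by
      rintro j j' h2 h3 rfl
      exact absurd (h.eq_of_vertex_eq (h2.trans h3.symm)) (by decide)
    have hua := (ha a).2 (Or.inl rfl)
    have hua' := (ha a').2 (Or.inr rfl)
    have hub := (hb b).2 (Or.inl rfl)
    have hub' := (hb b').2 (Or.inr rfl)
    obtain ⟨c, -, -, hca⟩ := exists_lift (h.frame a).norm_X 0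
    obtain ⟨c', l1, m1, hca'⟩ := exists_lift (h.frame a').norm_X c
    obtain ⟨d, l2, m2, hcb⟩ := exists_lift (h.frame b).norm_Y c
    obtain ⟨d', l3, m3, hcb'⟩ := exists_lift (h.frame b').norm_Y c
    have hca2 : X a = exp ((c + (-1 : ℤ) * (2 * Real.pi) : ℝ) * I) := by
      rw [exp_add_int_mul, hca]
    have hca'2 : X a' = exp ((c' + (1 : ℤ) * (2 * Real.pi) : ℝ) * I) := by
      rw [exp_add_int_mul, hca']
    have ga := h.germ_a hua
    have ga2 := h.germ_a hua
    have ga' := h.germ_a hua'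
    have gb := h.germ_b hub
    have gb' := h.germ_b hub'
    rw [hca] at ga
    rw [hca2] at ga2
    rw [hca'] at ga'
    rw [hcb] at gb
    rw [hcb'] at gb'
    have n1 : c' + α ≤ c := by
      rcases h.separated haa ga ga' (Or.inl rfl) (Or.inl rfl) with h | h <;> linarith
    have n2 : d + (Real.pi - α) ≤ c := by
      rcases h.separated (hab hua hub) ga gb (Or.inl rfl) (Or.inr rfl) with h | h <;> linarith
    have n3 : d' + (Real.pi - α) ≤ c := by
      rcases h.separated (hab hua hub') ga gb' (Or.inl rfl) (Or.inr rfl) with h | h <;> linarith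
    have o1 : c - 2 * Real.pi + α ≤ c' := by
      rcases h.separated haa ga2 ga' (Or.inl rfl) (Or.inl rfl) with h | h <;>
        push_cast at h <;> linarith
    have o2 : c - 2 * Real.pi + α ≤ d := by
      rcases h.separated (hab hua hub) ga2 gb (Or.inl rfl) (Or.inr rfl) with h | h <;>
        push_cast at h <;> linarith
    have o3 : c - 2 * Real.pi + α ≤ d' := by
      rcases h.separated (hab hua hub') ga2 gb' (Or.inl rfl) (Or.inr rfl) with h | h <;>
        push_cast at h <;> linarith
    -- The alternating order: the two angles `α` start in opposite directions, and each angle `π -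
    -- α` ends where an angle `α` begins.
    have alt : c' = c - Real.pi → d = c' - (Real.pi - α) ∨ d = c - (Real.pi - α) →
        d' = c' - (Real.pi - α) ∨ d' = c - (Real.pi - α) → X e ^ 4 = X f ^ 4 := by
      intro e1 e2 e3
      have x1 : X a' ^ 4 = X a ^ 4 := by rw [hca', e1, exp_sub_pi, hca]; ring
      have x2 : X b ^ 4 = X a ^ 4 := by
        rw [h.pow_four_of_dir hcb]
        rcases e2 with e2 | e2 <;> rw [e2, sub_add_cancel]
        · rw [← hca', x1]
        · rw [hca]
      have x3 : X b' ^ 4 = X a ^ 4 := by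
        rw [h.pow_four_of_dir hcb']
        rcases e3 with e3 | e3 <;> rw [e3, sub_add_cancel]
        · rw [← hca', x1]
        · rw [hca]
      rcases (ha f).1 hf with rfl | rfl <;> rcases (hb e).1 he with rfl | rfl <;>
        simp only [x1, x2, x3]
    -- The arcs of `a'`, `b`, `b'` are ordered within the turn below `a`. If `a'` comes last or
    -- first among them, the pattern is that of `aabbVertices`, against `hu`; if it lies between `b`
    -- and `b'`, the order alternates. The other two cases are cyclic and inconsistent.
    rcases h.separated (hab hua' hub) ga' gb (Or.inl rfl) (Or.inr rfl) with r1 | r1 <;>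
    rcases h.separated (hab hua' hub') ga' gb' (Or.inl rfl) (Or.inr rfl) with r2 | r2 <;>
    rcases h.separated hbb gb gb' (Or.inr rfl) (Or.inr rfl) with r3 | r3
    · refine absurd (h.mem_aabbVertices (a := a') (a' := a) (b := b') (b' := b)
        (c := c' + (1 : ℤ) * (2 * Real.pi)) haa.symm hbb.symm (fun j => (ha j).trans or_comm)
        (fun j => (hb j).trans or_comm) hc hca'2 ?_ ?_ ?_) hu
      · rw [hca]; congr 3; push_cast; linarith
      · rw [hcb']; congr 3; push_cast; linarith
      · rw [hcb]; congr 3; push_cast; linarith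
    · refine absurd (h.mem_aabbVertices (a := a') (a' := a) (b := b) (b' := b')
        (c := c' + (1 : ℤ) * (2 * Real.pi)) haa.symm hbb (fun j => (ha j).trans or_comm)
        hb hc hca'2 ?_ ?_ ?_) hu
      · rw [hca]; congr 3; push_cast; linarith
      · rw [hcb]; congr 3; push_cast; linarith
      · rw [hcb']; congr 3; push_cast; linarith
    · exfalso; linarith
    · exact alt (by linarith) (Or.inr (by linarith)) (Or.inl (by linarith))
    · exact alt (by linarith) (Or.inl (by linarith)) (Or.inr (by linarith))
    · exfalso; linarith
    · refine absurd (h.mem_aabbVertices haa hbb.symm ha (fun j => (hb j).trans or_comm) hc hca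
        ?_ ?_ ?_) hu
      · rw [hca']; congr 3; linarith
      · rw [hcb']; congr 3; linarith
      · rw [hcb]; congr 3; linarith
    · refine absurd (h.mem_aabbVertices haa hbb ha hb hc hca ?_ ?_ ?_) hu
      · rw [hca']; congr 3; linarith
      · rw [hcb]; congr 3; linarith
      · rw [hcb']; congr 3; linarith

end FramedTiling

end

/-! ### Permutations following the edges of a graph -/

lemma finRotate_val (m : ℕ) (i : Fin m) : ((finRotate m i : Fin m) : ℕ) = (i + 1) % m := by
  cases m with
  | zero => exact i.elim0
  | succ n => rw [finRotate_apply, Fin.val_add, Fin.val_one', Nat.add_mod_mod]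

lemma eq_of_finRotate_invariant {A : Type*} {m : ℕ} {g : Fin m → A}
    (hg : ∀ i, g (finRotate m i) = g i) (i i' : Fin m) : g i = g i' := by
  have key : ∀ (n : ℕ) (hn : n < m), g ⟨n, hn⟩ = g ⟨0, by omega⟩ := by
    intro n
    induction n with
    | zero => intro _; rfl
    | succ n ih =>
      intro hn
      rw [← ih (by omega), ← hg ⟨n, by omega⟩]
      congr 1
      apply Fin.ext
      rw [finRotate_val, Nat.mod_eq_of_lt hn]
  rw [key i i.2, key i' i'.2]

lemma DirGraph.IsClosedTrail.card_subtype {V E : Type*} {G : DirGraph V E} {m : ℕ} {γ : Fin m → E}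
    (hγ : G.IsClosedTrail γ) {P : E → Prop} (hP : ∀ e, P e → e ∈ Set.range γ) :
    Nat.card {i // P (γ i)} = Nat.card {e // P e} := by
  refine Nat.card_congr (Equiv.ofBijective (fun i => ⟨γ i.1, i.2⟩) ⟨?_, ?_⟩)
  · rintro ⟨i, hi⟩ ⟨i', hi'⟩ h
    simpa using hγ.injective (congrArg Subtype.val h)
  · rintro ⟨e, he⟩
    obtain ⟨i, rfl⟩ := hP e he
    exact ⟨⟨i, he⟩, rfl⟩

/-- In a graph with Eulerian components, every vertex has as many incoming as outgoing edges. -/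
lemma DirGraph.ComponentwiseEulerian.degree_eq {V E : Type*} {G : DirGraph V E}
    (hG : G.ComponentwiseEulerian) (u : V) :
    Nat.card {e // G.terminus e = u} = Nat.card {e // G.origin e = u} := by
  by_cases hu : u ∈ G.vertexSet
  · obtain ⟨m, γ, hγ, hr⟩ := hG u hu
    rw [← hγ.card_subtype (P := fun e => G.terminus e = u),
      ← hγ.card_subtype (P := fun e => G.origin e = u)]
    · refine Nat.card_congr ((finRotate m).subtypeEquiv fun i => ?_)
      rw [hγ.consecutive]
    · rintro e rfl
      rw [hr]; exact Relation.EqvGen.refl _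
    · rintro e rfl
      rw [hr]; exact Relation.EqvGen.symm _ _ (Relation.EqvGen.rel _ _ ⟨e, rfl, rfl⟩)
  · have h1 : IsEmpty {e // G.terminus e = u} :=
      ⟨fun e => hu (e.2 ▸ G.terminus_mem e.1)⟩
    have h2 : IsEmpty {e // G.origin e = u} :=
      ⟨fun e => hu (e.2 ▸ G.origin_mem e.1)⟩
    rw [Nat.card_of_isEmpty, Nat.card_of_isEmpty]

lemma exists_equiv_of_pair {E : Type*} {P Q : E → Prop} {e e' f f' : E} (he : e ≠ e')
    (hf : f ≠ f') (hP : ∀ x, P x ↔ x = e ∨ x = e') (hQ : ∀ x, Q x ↔ x = f ∨ x = f') :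
    ∃ F : {x // P x} ≃ {x // Q x}, ∀ x, (x.1 = e ∧ (F x).1 = f) ∨ (x.1 = e' ∧ (F x).1 = f') := by
  classical
  refine ⟨⟨fun x => if x.1 = e then ⟨f, (hQ f).2 (Or.inl rfl)⟩ else ⟨f', (hQ f').2 (Or.inr rfl)⟩,
    fun x => if x.1 = f then ⟨e, (hP e).2 (Or.inl rfl)⟩ else ⟨e', (hP e').2 (Or.inr rfl)⟩,
    ?_, ?_⟩, ?_⟩
  · rintro ⟨x, hx⟩
    rcases (hP x).1 hx with rfl | rfl
    · simp
    · simp [he.symm, hf.symm]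
  · rintro ⟨x, hx⟩
    rcases (hQ x).1 hx with rfl | rfl
    · simp
    · simp [he.symm, hf.symm]
  · rintro ⟨x, hx⟩
    rcases (hP x).1 hx with rfl | rfl
    · simp
    · simp [he.symm]

/-- Every edge enters exactly one vertex and leaves exactly one, so bijections from incoming to
outgoing edges, chosen independently at all vertices, glue to a permutation of the edges. -/
lemma exists_perm_of_fiber_equiv {V E : Type*} {s t : E → V} {R : E → E → Prop}
    (h : ∀ u, ∃ F : {e // t e = u} ≃ {e // s e = u}, ∀ e, R e.1 (F e).1) :
    ∃ σ : Equiv.Perm E, ∀ e, t e = s (σ e) ∧ R e (σ e) := by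
  choose F hF using h
  refine ⟨(Equiv.sigmaFiberEquiv t).symm.trans
    ((Equiv.sigmaCongrRight F).trans (Equiv.sigmaFiberEquiv s)), fun e => ⟨?_, ?_⟩⟩
  · exact (F (t e) ⟨e, rfl⟩).2.symm
  · exact hF (t e) ⟨e, rfl⟩

open Equiv.Perm in
-- Exchanging the successors of two elements of one cycle never leads out of a cycle of `σ`, so the
-- partition into cycles can only become finer.
lemma sameCycle_of_mul_swap {E : Type*} [Finite E] [DecidableEq E] {σ : Equiv.Perm E} {e e' : E}
    (h : σ.SameCycle e e') {x y : E} (hxy : (σ * Equiv.swap e e').SameCycle x y) :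
    σ.SameCycle x y := by
  have step : ∀ z, σ.SameCycle z ((σ * Equiv.swap e e') z) := by
    intro z
    rw [mul_apply]
    by_cases h1 : z = e
    · rw [h1, Equiv.swap_apply_left]; exact sameCycle_apply_right.2 h
    · by_cases h2 : z = e'
      · rw [h2, Equiv.swap_apply_right]; exact sameCycle_apply_right.2 h.symm
      · rw [Equiv.swap_apply_of_ne_of_ne h1 h2]; exact sameCycle_apply_right.2 (SameCycle.refl _ _)
  obtain ⟨n, rfl⟩ := hxy.exists_nat_pow_eq
  clear hxy
  induction n with
  | zero => exact SameCycle.refl _ _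
  | succ n ih => rw [pow_succ', mul_apply]; exact ih.trans (step _)

open Equiv.Perm in
lemma not_sameCycle_mul_swap {E : Type*} [Finite E] [DecidableEq E] {σ : Equiv.Perm E} {e e' : E}
    (h : σ.SameCycle e e') (hne : e ≠ e') : ¬ (σ * Equiv.swap e e').SameCycle e' e := by
  classical
  intro hs
  have hex : ∃ n : ℕ, (σ ^ n) e = e' := h.exists_nat_pow_eq
  obtain ⟨k, hk, hmin⟩ : ∃ k : ℕ, (σ ^ k) e = e' ∧ ∀ l < k, (σ ^ l) e ≠ e' :=
    ⟨Nat.find hex, Nat.find_spec hex, fun l hl => Nat.find_min hex hl⟩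
  have hk0 : 1 ≤ k := by
    by_contra! hc
    obtain rfl : k = 0 := by omega
    exact hne hk
  have hne' : ∀ i, 1 ≤ i → i ≤ k → (σ ^ i) e ≠ e := by
    intro i h1 h2 h3
    refine hmin (k - i) (by omega) ?_
    rw [← hk]
    conv_rhs => rw [← Nat.sub_add_cancel h2, pow_add, mul_apply, h3]
  -- From `e'` the new permutation jumps to `σ e`, follows `σ` up to the first occurrence of `e'`
  -- and then repeats, so it never meets `e`.
  have inv : ∀ n : ℕ, ∃ i, 1 ≤ i ∧ i ≤ k ∧ ((σ * Equiv.swap e e') ^ n) e' = (σ ^ i) e := by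
    intro n
    induction n with
    | zero => exact ⟨k, hk0, le_rfl, hk.symm⟩
    | succ n ih =>
      obtain ⟨i, h1, h2, h3⟩ := ih
      rw [pow_succ', mul_apply, h3, mul_apply]
      rcases h2.eq_or_lt with rfl | h2
      · exact ⟨1, le_rfl, hk0, by rw [hk, Equiv.swap_apply_right, pow_one]⟩
      · refine ⟨i + 1, by omega, h2, ?_⟩
        rw [Equiv.swap_apply_of_ne_of_ne (hne' i h1 h2.le) (hmin i h2), pow_succ', mul_apply]
  obtain ⟨n, hn⟩ := hs.exists_nat_pow_eq
  obtain ⟨i, h1, h2, h3⟩ := inv n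
  exact hne' i h1 h2 (h3.symm.trans hn)

/-- A permutation following the edges of a finite graph can be chosen so that none of its cycles
passes twice through a vertex outside `W`; at the vertices of `W` it is left unchanged. -/
lemma exists_perm_simple {V E : Type*} [Finite E] {s t : E → V} {W : Set V}
    {R : E → E → Prop} (h : ∃ σ : Equiv.Perm E, ∀ e, t e = s (σ e) ∧ (t e ∈ W → R e (σ e))) :
    ∃ σ : Equiv.Perm E, (∀ e, t e = s (σ e) ∧ (t e ∈ W → R e (σ e))) ∧
      ∀ e e', σ.SameCycle e e' → t e ∉ W → t e = t e' → e = e' := by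
  classical
  have : Nonempty {σ : Equiv.Perm E // ∀ e, t e = s (σ e) ∧ (t e ∈ W → R e (σ e))} :=
    ⟨⟨h.choose, h.choose_spec⟩⟩
  -- The permutation with the fewest pairs in a common cycle is taken. If a cycle entered a vertex
  -- outside `W` by two edges, exchanging their successors would be admissible and would split the
  -- cycle.
  obtain ⟨⟨σ, hσ⟩, hmin⟩ := Finite.exists_min
    fun σ : {σ : Equiv.Perm E // ∀ e, t e = s (σ e) ∧ (t e ∈ W → R e (σ e))} =>
      Set.ncard {q : E × E | σ.1.SameCycle q.1 q.2}
  refine ⟨σ, hσ, fun e e' hs hW ht => ?_⟩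
  by_contra hne
  refine absurd (hmin ⟨σ * Equiv.swap e e', fun x => ?_⟩) (not_le.2 ?_)
  · rw [Equiv.Perm.mul_apply]
    by_cases h1 : x = e
    · rw [h1, Equiv.swap_apply_left]
      exact ⟨ht.trans (hσ e').1, fun h => absurd h hW⟩
    · by_cases h2 : x = e'
      · rw [h2, Equiv.swap_apply_right]
        exact ⟨ht.symm.trans (hσ e).1, fun h => absurd h (ht ▸ hW)⟩
      · rw [Equiv.swap_apply_of_ne_of_ne h1 h2]; exact hσ x
  · refine Set.ncard_lt_ncard ⟨fun q hq => sameCycle_of_mul_swap hs hq, fun hsub => ?_⟩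
    exact not_sameCycle_mul_swap hs hne (hsub (a := (e', e)) hs.symm)

/-- The decomposition of a finite set into the cycles of a permutation. -/
lemma exists_cycle_decomposition {E : Type*} [Finite E] (σ : Equiv.Perm E) :
    ∃ (k : ℕ) (m : Fin k → ℕ) (γ : (r : Fin k) → Fin (m r) → E),
      (∀ r, 0 < m r ∧ Function.Injective (γ r) ∧ (∀ i, γ r (finRotate _ i) = σ (γ r i)) ∧
        ∀ i i', σ.SameCycle (γ r i) (γ r i')) ∧
      Function.Bijective fun e : (r : Fin k) × Fin (m r) => γ e.1 e.2 := by
  classical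
  have : Finite (Quotient (Equiv.Perm.SameCycle.setoid σ)) := inferInstance
  obtain ⟨k, ⟨F⟩⟩ := Finite.exists_equiv_fin (Quotient (Equiv.Perm.SameCycle.setoid σ))
  set rep : Fin k → E := fun r => (F.symm r).out with hrep
  have hsame : ∀ r (n : ℕ), σ.SameCycle (rep r) (σ^[n] (rep r)) := fun r n => by
    rw [← Equiv.Perm.coe_pow]
    exact Equiv.Perm.sameCycle_pow_right.2 (Equiv.Perm.SameCycle.refl _ _)
  have hpos : ∀ r, 0 < Function.minimalPeriod σ (rep r) := fun r =>
    Function.minimalPeriod_pos_of_mem_periodicPts (σ.injective.mem_periodicPts _)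
  have hinj : ∀ r, Function.Injective fun i : Fin (Function.minimalPeriod σ (rep r)) =>
      σ^[i] (rep r) := fun r i i' hi =>
    Fin.ext (Function.iterate_injOn_Iio_minimalPeriod i.2 i'.2 hi)
  refine ⟨k, fun r => Function.minimalPeriod σ (rep r), fun r i => σ^[i] (rep r),
    fun r => ⟨hpos r, hinj r, fun i => ?_, fun i i' => (hsame r i).symm.trans (hsame r i')⟩,
    ?_, ?_⟩
  · dsimp only
    rw [finRotate_val, Function.iterate_mod_minimalPeriod_eq, Function.iterate_succ_apply']
  · rintro ⟨r, i⟩ ⟨r', i'⟩ h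
    have h : σ^[i] (rep r) = σ^[i'] (rep r') := h
    have h1 : σ.SameCycle (rep r) (rep r') := (h ▸ hsame r i).trans (hsame r' i').symm
    have h2 : F.symm r = F.symm r' := by
      rw [← Quotient.out_eq (F.symm r), ← Quotient.out_eq (F.symm r')]
      exact Quotient.sound h1
    obtain rfl := F.symm.injective h2
    exact congrArg (Sigma.mk r) (hinj r h)
  · intro e
    have h1 : σ.SameCycle (rep (F ⟦e⟧)) e := by
      have := Quotient.mk_out (s := Equiv.Perm.SameCycle.setoid σ) e
      simp only [hrep, Equiv.symm_apply_apply]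
      exact this
    obtain ⟨n, hn⟩ := h1.exists_nat_pow_eq
    refine ⟨⟨F ⟦e⟧, ⟨n % _, Nat.mod_lt _ (hpos _)⟩⟩, ?_⟩
    simp only [Function.iterate_mod_minimalPeriod_eq]
    rw [← Equiv.Perm.coe_pow, hn]

/-! ### Sums of unit vectors -/

/-- The eight directions `±1, ±i, ±ω, ±iω` are distinct, so that a vector among them is the
combination of `1, i, ω, iω` with coefficients counting its occurrences with sign. -/
lemma direction_indicators {ω y : ℂ} (hre : 0 < ω.re) (him : 0 < ω.im)
    (hy : y = 1 ∨ y = -1 ∨ y = I ∨ y = -I ∨ y = ω ∨ y = -ω ∨ y = I * ω ∨ y = -(I * ω))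
    {δ : ℂ → ℤ} (hδ : ∀ w, (y = w → y ≠ -w → δ w = 1) ∧ (y ≠ w → y = -w → δ w = -1) ∧
      (y ≠ w → y ≠ -w → δ w = 0)) :
    y = δ 1 + δ I * I + δ ω * ω + δ (I * ω) * (I * ω) ∧
      Even (δ 1 + δ I + δ ω + δ (I * ω) - 1) := by
  obtain ⟨C, S⟩ := ω
  simp only at hre him
  have n1 : C ≠ -S := by linarith
  have n2 : S ≠ -C := by linarith
  have n3 : -S ≠ C := by linarith
  have n4 : -C ≠ S := by linarith
  have n5 : C ≠ -C := by linarith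
  have n6 : S ≠ -S := by linarith
  have n7 : (1 : ℝ) ≠ -1 := by norm_num
  have n8 : (-1 : ℝ) ≠ 1 := by norm_num
  have h1 := hδ 1
  have h2 := hδ I
  have h3 := hδ ⟨C, S⟩
  have h4 := hδ (I * ⟨C, S⟩)
  rcases hy with rfl | rfl | rfl | rfl | rfl | rfl | rfl | rfl <;>
    simp [Complex.ext_iff, hre.ne', him.ne', hre.ne, him.ne, n1, n2, n3, n4,
      n5, n5.symm, n6, n6.symm, n7, n8] at h1 h2 h3 h4 <;>
    rw [h1, h2, h3, h4] <;> exact ⟨by push_cast; ring, by decide⟩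

lemma eq_of_pow_four_eq {x z : ℂ} (h : x ^ 4 = z ^ 4) :
    x = z ∨ x = -z ∨ x = z * I ∨ x = -(z * I) := by
  have h1 : (x - z) * ((x + z) * ((x - z * I) * (x + z * I))) = 0 := by
    linear_combination h - (x ^ 2 - z ^ 2) * z ^ 2 * I_sq
  rcases mul_eq_zero.1 h1 with h1 | h1
  · exact Or.inl (sub_eq_zero.1 h1)
  rcases mul_eq_zero.1 h1 with h1 | h1
  · exact Or.inr (Or.inl (eq_neg_of_add_eq_zero_left h1))
  rcases mul_eq_zero.1 h1 with h1 | h1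
  · exact Or.inr (Or.inr (Or.inl (sub_eq_zero.1 h1)))
  · exact Or.inr (Or.inr (Or.inr (eq_neg_of_add_eq_zero_left h1)))

/-- The relation reads `a + b i = -(c + d i) ω`; comparing squared norms eliminates `ω`. -/
lemma sq_add_sq_eq_of_sum_eq_zero {a b c d : ℤ} {ω : ℂ} (hω : ‖ω‖ = 1)
    (h : (a : ℂ) + b * I + c * ω + d * (I * ω) = 0) : a ^ 2 + b ^ 2 = c ^ 2 + d ^ 2 := by
  have h1 : (a : ℂ) + b * I = -((c + d * I) * ω) := by linear_combination h
  have h2 := congrArg normSq h1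
  rw [normSq_neg, normSq_mul, normSq_eq_norm_sq ω, hω] at h2
  have h3 : (a : ℝ) ^ 2 + (b : ℝ) ^ 2 = (c : ℝ) ^ 2 + (d : ℝ) ^ 2 := by
    simp [normSq_apply] at h2
    linear_combination h2
  exact_mod_cast h3

lemma even_sum_of_sq_add_sq_eq {a b c d : ℤ} (h : a ^ 2 + b ^ 2 = c ^ 2 + d ^ 2) :
    Even (a + b + c + d) := by
  have h1 : Even (a ^ 2 + b ^ 2 + (c ^ 2 + d ^ 2)) := ⟨c ^ 2 + d ^ 2, by rw [h]⟩
  simp only [Int.even_add, Int.even_pow' two_ne_zero] at h1 ⊢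
  tauto

/-- A closed sequence of unit vectors among `±z, ±zi, ±zω, ±ziω` has even length, and the signed
numbers of its members of each direction satisfy `a² + b² = c² + d²`. -/
lemma counts_of_sum_eq_zero {m : ℕ} {v : Fin m → ℂ} {z ω : ℂ} (hz : ‖z‖ = 1) (hω : ‖ω‖ = 1)
    (hre : 0 < ω.re) (him : 0 < ω.im) (hsum : ∑ i, v i = 0)
    (hv : ∀ i, v i ∈ ({z, -z, z * I, -(z * I), z * ω, -(z * ω), z * (I * ω),
      -(z * (I * ω))} : Set ℂ)) {n : ℂ → ℤ}
    (hn : ∀ w, n w = (Nat.card {i // v i = w} : ℤ) - (Nat.card {i // v i = -w} : ℤ)) :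
    Even m ∧ n z ^ 2 + n (z * I) ^ 2 = n (z * ω) ^ 2 + n (z * (I * ω)) ^ 2 ∧
      Even (n z + n (z * I) + n (z * ω) + n (z * (I * ω))) := by
  classical
  have hz0 : z ≠ 0 := by rintro rfl; simp at hz
  set δ : Fin m → ℂ → ℤ := fun i w => (if v i = z * w then 1 else 0) -
    (if v i = -(z * w) then 1 else 0) with hδ
  have hnδ : ∀ w, n (z * w) = ∑ i, δ i w := by
    intro w
    rw [hn, Nat.card_eq_fintype_card, Nat.card_eq_fintype_card, Fintype.card_subtype,
      Fintype.card_subtype, Finset.sum_sub_distrib, Finset.sum_boole, Finset.sum_boole]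
  have key : ∀ i, v i = z * (δ i 1 + δ i I * I + δ i ω * ω + δ i (I * ω) * (I * ω)) ∧
      Even (δ i 1 + δ i I + δ i ω + δ i (I * ω) - 1) := by
    intro i
    have hy : v i = z * (v i / z) := by field_simp
    have h := direction_indicators (ω := ω) (y := v i / z) hre him ?_ (δ := δ i) ?_
    · exact ⟨by rw [← h.1]; exact hy, h.2⟩
    · have := hv i
      simp only [Set.mem_insert_iff, Set.mem_singleton_iff] at this
      simp only [div_eq_iff hz0]
      rcases this with h | h | h | h | h | h | h | h <;> rw [h]
      · left; ring
      · right; left; ring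
      · right; right; left; ring
      · right; right; right; left; ring
      · right; right; right; right; left; ring
      · right; right; right; right; right; left; ring
      · right; right; right; right; right; right; left; ring
      · right; right; right; right; right; right; right; ring
    · intro w
      have e1 : v i = z * w ↔ v i / z = w := by rw [div_eq_iff hz0, mul_comm]
      have e2 : v i = -(z * w) ↔ v i / z = -w := by rw [div_eq_iff hz0, neg_mul, mul_comm]
      simp only [hδ, e1, e2]
      refine ⟨fun h1 h2 => ?_, fun h1 h2 => ?_, fun h1 h2 => ?_⟩
      · rw [if_pos h1, if_neg h2]; rfl
      · rw [if_neg h1, if_pos h2]; rfl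
      · rw [if_neg h1, if_neg h2]; rfl
  have hn1 : n z = ∑ i, δ i 1 := by rw [← hnδ, mul_one]
  have hsq : n z ^ 2 + n (z * I) ^ 2 = n (z * ω) ^ 2 + n (z * (I * ω)) ^ 2 := by
    refine sq_add_sq_eq_of_sum_eq_zero hω ?_
    rw [hn1, hnδ, hnδ, hnδ]
    push_cast
    rw [Finset.sum_mul, Finset.sum_mul, Finset.sum_mul, ← Finset.sum_add_distrib,
      ← Finset.sum_add_distrib, ← Finset.sum_add_distrib]
    refine (mul_eq_zero.1 ?_).resolve_left hz0
    rw [Finset.mul_sum, ← hsum]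
    exact Finset.sum_congr rfl fun i _ => (key i).1.symm
  have heven := even_sum_of_sq_add_sq_eq hsq
  refine ⟨?_, hsq, heven⟩
  -- Each vector contributes `1` or `-1` to exactly one of the four signed counts, so their sum has
  -- the parity of `m`.
  have h1 : Even (n z + n (z * I) + n (z * ω) + n (z * (I * ω)) - m) := by
    have : n z + n (z * I) + n (z * ω) + n (z * (I * ω)) - m =
        ∑ i, (δ i 1 + δ i I + δ i ω + δ i (I * ω) - 1) := by
      rw [hn1, hnδ, hnδ, hnδ,
        Finset.sum_sub_distrib (fun i => δ i 1 + δ i I + δ i ω + δ i (I * ω)), Finset.sum_add_distrib,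
        Finset.sum_add_distrib, Finset.sum_add_distrib]
      simp
    rw [this]
    exact Finset.even_sum _ fun i _ => (key i).2
  have h2 : Even (m : ℤ) := by
    have := heven.sub h1
    rwa [sub_sub_cancel] at this
  exact_mod_cast h2

/-! ### Feasible cycles and their decomposition -/

section

variable {α : ℝ} {p : Fin 4 → ℂ} {Ω : Set ℂ} {N : ℕ} {φ : Fin N → ℂ ≃ᵢ ℂ} {X Y : Fin N → ℂ}

lemma sum_unitEdgeVector {m : ℕ} {γ : Fin m → Fin N}
    (hγ : (hypotenuseGraph p φ).IsClosedTrail γ) : ∑ i, unitEdgeVector p φ (γ i) = 0 := by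
  simp only [unitEdgeVector]
  rw [← Finset.sum_div, Finset.sum_sub_distrib,
    ← Equiv.sum_comp (finRotate m) fun i => (hypotenuseGraph p φ).origin (γ i),
    Finset.sum_congr rfl fun i _ => hγ.consecutive i, sub_self, zero_div]

namespace FramedTiling

variable (h : FramedTiling α p Ω φ X Y)
include h

/-- At a vertex of `aabbVertices` there are exactly two incoming and two outgoing edges, matched by
the pairing. At any other vertex equality of degrees provides some bijection. -/
lemma exists_perm (hE : (hypotenuseGraph p φ).ComponentwiseEulerian) :
    ∃ σ : Equiv.Perm (Fin N), ∀ e,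
      (hypotenuseGraph p φ).terminus e = (hypotenuseGraph p φ).origin (σ e) ∧
      ((hypotenuseGraph p φ).terminus e ∈ aabbVertices p φ α →
        Paired p φ α ((hypotenuseGraph p φ).terminus e) e (σ e)) := by
  refine exists_perm_of_fiber_equiv (t := (hypotenuseGraph p φ).terminus)
    (s := (hypotenuseGraph p φ).origin)
    (R := fun e f => (hypotenuseGraph p φ).terminus e ∈ aabbVertices p φ α →
        Paired p φ α ((hypotenuseGraph p φ).terminus e) e f) fun u => ?_
  by_cases hu : u ∈ aabbVertices p φ α
  · obtain ⟨-, x, hx⟩ := hu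
    obtain ⟨⟨hi0, hi1, hi2, hi3⟩, hv, hne⟩ := h.pattern_vertices hx
    have hmem : ∀ c : Fin N × Fin 4, φ c.1 (p c.2) = u → ∃ n, x n = c := fun c hc => by
      have : c ∈ Set.range x := by rw [hx.range_eq]; exact hc
      exact this
    have hP : ∀ e, (hypotenuseGraph p φ).terminus e = u ↔ e = (x 3).1 ∨ e = (x 2).1 := by
      refine fun e => ⟨fun he => ?_, fun he => ?_⟩
      · obtain ⟨n, hn⟩ := hmem (e, 1) he
        have hn2 : (x n).2 = 1 := by rw [hn]
        have hn1 : (x n).1 = e := by rw [hn]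
        fin_cases n
        · exact absurd (hi0.symm.trans hn2) (by decide)
        · exact absurd (hi1.symm.trans hn2) (by decide)
        · exact Or.inr hn1.symm
        · exact Or.inl hn1.symm
      · rcases he with rfl | rfl
        · have := hv 3; rwa [hi3] at this
        · have := hv 2; rwa [hi2] at this
    have hQ : ∀ e, (hypotenuseGraph p φ).origin e = u ↔ e = (x 0).1 ∨ e = (x 1).1 := by
      refine fun e => ⟨fun he => ?_, fun he => ?_⟩
      · obtain ⟨n, hn⟩ := hmem (e, 0) he
        have hn2 : (x n).2 = 0 := by rw [hn]
        have hn1 : (x n).1 = e := by rw [hn]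
        fin_cases n
        · exact Or.inl hn1.symm
        · exact Or.inr hn1.symm
        · exact absurd (hi2.symm.trans hn2) (by decide)
        · exact absurd (hi3.symm.trans hn2) (by decide)
      · rcases he with rfl | rfl
        · have := hv 0; rwa [hi0] at this
        · have := hv 1; rwa [hi1] at this
    obtain ⟨F, hF⟩ := exists_equiv_of_pair (hne 3 2 (by decide)) (hne 0 1 (by decide)) hP hQ
    refine ⟨F, fun e _ => ⟨x, ?_, hF e⟩⟩
    rw [e.2]; exact hx
  · obtain ⟨F⟩ : Nonempty ({e // (hypotenuseGraph p φ).terminus e = u} ≃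
        {e // (hypotenuseGraph p φ).origin e = u}) := by
      classical
      have := hE.degree_eq u
      rw [Nat.card_eq_fintype_card, Nat.card_eq_fintype_card] at this
      exact Fintype.card_eq.1 this
    exact ⟨F, fun e he => absurd (e.2 ▸ he) hu⟩

/-- The cycles of a transition permutation that is simple outside `aabbVertices` are feasible
cycles, and they partition the edges. -/
lemma exists_feasible_decomposition (hE : (hypotenuseGraph p φ).ComponentwiseEulerian) :
    ∃ (k : ℕ) (m : Fin k → ℕ) (γ : (r : Fin k) → Fin (m r) → Fin N),
      (∀ r, IsFeasibleCycle p φ α (γ r)) ∧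
      Function.Bijective fun e : (r : Fin k) × Fin (m r) => γ e.1 e.2 := by
  obtain ⟨σ, hσ, hsimple⟩ := exists_perm_simple (h.exists_perm hE)
  obtain ⟨k, m, γ, hγ, hb⟩ := exists_cycle_decomposition σ
  refine ⟨k, m, γ, fun r => ?_, hb⟩
  obtain ⟨h0, hinj, hnext, hsame⟩ := hγ r
  refine ⟨h0, ⟨hinj, fun i => ?_⟩, fun i hi => ?_, fun i i' hi ht => ?_⟩
  · rw [hnext]; exact (hσ _).1
  · rw [hnext]; exact (hσ _).2 hi
  · exact hinj (hsimple _ _ (hsame i i') hi ht)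

/-- Consecutive edges have equal invariants: by the pairing at vertices of `aabbVertices`, and
because all edges at the vertex agree elsewhere. -/
lemma feasible_pow_four_eq (hE : (hypotenuseGraph p φ).ComponentwiseEulerian) {m : ℕ}
    {γ : Fin m → Fin N} (hγ : IsFeasibleCycle p φ α γ) (i i' : Fin m) :
    X (γ i) ^ 4 = X (γ i') ^ 4 := by
  refine eq_of_finRotate_invariant (g := fun i => X (γ i) ^ 4) (fun i => Eq.symm ?_) i i'
  by_cases hu : (hypotenuseGraph p φ).terminus (γ i) ∈ aabbVertices p φ α
  · exact h.pow_four_eq_of_paired (hγ.paired i hu)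
  · exact h.pow_four_eq_of_notMem hu (hE.degree_eq _) rfl (hγ.closedTrail.consecutive i).symm

lemma unitEdgeVector_eq (j : Fin N) :
    unitEdgeVector p φ j = X j ∨ unitEdgeVector p φ j = X j * exp (α * I) := by
  have := (h.frame j).edge
  rwa [(φ j).isometry.dist_eq] at this

end FramedTiling

lemma exists_framedTiling {q s : ℂ} (hp : IsRightTrapezoid α p) (hs : s ≠ 0)
    (hφ : IsTiling (squareRegion q s) (region p) φ) :
    ∃ X Y : Fin N → ℂ, FramedTiling α p (squareRegion q s) φ X Y := by
  choose X Y h using fun j => exists_frame hp (φ j)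
  exact ⟨X, Y, hp, hφ, balanced_squareRegion q hs, h⟩

end

end TrapezoidTiling

end

theorem theorem4p1 (α : ℝ) (p : Fin 4 → ℂ) (hp : TrapezoidTiling.IsRightTrapezoid α p)
    (q s : ℂ) (hs : s ≠ 0) (N : ℕ) (φ : Fin N → ℂ ≃ᵢ ℂ)
    (hφ : TrapezoidTiling.IsTiling (TrapezoidTiling.squareRegion q s)
      (TrapezoidTiling.region p) φ)
    (hE : (TrapezoidTiling.hypotenuseGraph p φ).ComponentwiseEulerian) :
    -- the number of tiles is even
    Even N ∧
    -- the graph is the union of edge-disjoint feasible cycles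
    (∃ (k : ℕ) (m : Fin k → ℕ) (γ : (r : Fin k) → Fin (m r) → Fin N),
      (∀ r, TrapezoidTiling.IsFeasibleCycle p φ α (γ r)) ∧
      Function.Bijective fun e : (r : Fin k) × Fin (m r) => γ e.1 e.2) ∧
    -- every feasible cycle has even length; up to a rotation `z` of the coordinate system its unit
    -- edge vectors are among `±1, ±i, ±ω, ±iω`, and the signed counts are related as stated
    (∀ (m : ℕ) (γ : Fin m → Fin N), TrapezoidTiling.IsFeasibleCycle p φ α γ →
      Even m ∧
      ∃ z ω : ℂ, ‖z‖ = 1 ∧ ω = Complex.exp ((α : ℂ) * Complex.I) ∧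
        (∀ i, TrapezoidTiling.unitEdgeVector p φ (γ i) ∈
          ({z, -z, z * Complex.I, -(z * Complex.I), z * ω, -(z * ω),
            z * (Complex.I * ω), -(z * (Complex.I * ω))} : Set ℂ)) ∧
        ∃ a b c d : ℤ,
          a = TrapezoidTiling.signedCount p φ γ z ∧
          b = TrapezoidTiling.signedCount p φ γ (z * Complex.I) ∧
          c = TrapezoidTiling.signedCount p φ γ (z * ω) ∧
          d = TrapezoidTiling.signedCount p φ γ (z * (Complex.I * ω)) ∧
          a ^ 2 + b ^ 2 = c ^ 2 + d ^ 2 ∧ Even (a + b + c + d)) := by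
  obtain ⟨X, Y, h⟩ := TrapezoidTiling.exists_framedTiling hp hs hφ
  have h3 : ∀ (m : ℕ) (γ : Fin m → Fin N), TrapezoidTiling.IsFeasibleCycle p φ α γ →
      Even m ∧
      ∃ z ω : ℂ, ‖z‖ = 1 ∧ ω = Complex.exp ((α : ℂ) * Complex.I) ∧
        (∀ i, TrapezoidTiling.unitEdgeVector p φ (γ i) ∈
          ({z, -z, z * Complex.I, -(z * Complex.I), z * ω, -(z * ω),
            z * (Complex.I * ω), -(z * (Complex.I * ω))} : Set ℂ)) ∧
        ∃ a b c d : ℤ,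
          a = TrapezoidTiling.signedCount p φ γ z ∧
          b = TrapezoidTiling.signedCount p φ γ (z * Complex.I) ∧
          c = TrapezoidTiling.signedCount p φ γ (z * ω) ∧
          d = TrapezoidTiling.signedCount p φ γ (z * (Complex.I * ω)) ∧
          a ^ 2 + b ^ 2 = c ^ 2 + d ^ 2 ∧ Even (a + b + c + d) := by
    intro m γ hγ
    -- The rotation `z` is the direction `X` of the first tile of the cycle; every other tile has a
    -- direction differing from it by a power of `i`.
    have hz := (h.frame (γ ⟨0, hγ.nonempty⟩)).norm_X
    have hmem : ∀ i, TrapezoidTiling.unitEdgeVector p φ (γ i) ∈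
        ({X (γ ⟨0, hγ.nonempty⟩), -X (γ ⟨0, hγ.nonempty⟩), X (γ ⟨0, hγ.nonempty⟩) * Complex.I,
          -(X (γ ⟨0, hγ.nonempty⟩) * Complex.I),
          X (γ ⟨0, hγ.nonempty⟩) * Complex.exp (α * Complex.I),
          -(X (γ ⟨0, hγ.nonempty⟩) * Complex.exp (α * Complex.I)),
          X (γ ⟨0, hγ.nonempty⟩) * (Complex.I * Complex.exp (α * Complex.I)),
          -(X (γ ⟨0, hγ.nonempty⟩) * (Complex.I * Complex.exp (α * Complex.I)))} : Set ℂ) := by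
      intro i
      have h4 := TrapezoidTiling.eq_of_pow_four_eq
        (h.feasible_pow_four_eq hE hγ i ⟨0, hγ.nonempty⟩)
      simp only [Set.mem_insert_iff, Set.mem_singleton_iff, ← mul_assoc]
      rcases h.unitEdgeVector_eq (γ i) with h5 | h5 <;> rw [h5] <;>
        rcases h4 with h4 | h4 | h4 | h4 <;> rw [h4] <;> simp [neg_mul]
    have hc := TrapezoidTiling.counts_of_sum_eq_zero hz
      (Complex.norm_exp_ofReal_mul_I α)
      (by
        rw [Complex.exp_ofReal_mul_I_re]
        exact Real.cos_pos_of_mem_Ioo ⟨by linarith [hp.pos, Real.pi_pos], hp.lt⟩)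
      (by
        rw [Complex.exp_ofReal_mul_I_im]
        exact Real.sin_pos_of_pos_of_lt_pi hp.pos (by linarith [hp.lt, Real.pi_pos]))
      (TrapezoidTiling.sum_unitEdgeVector hγ.closedTrail) hmem
      (n := TrapezoidTiling.signedCount p φ γ) fun w => rfl
    exact ⟨hc.1, _, _, hz, rfl, hmem, _, _, _, _, rfl, rfl, rfl, rfl, hc.2⟩
  obtain ⟨k, m, γ, hγ, hb⟩ := h.exists_feasible_decomposition hE
  refine ⟨?_, ⟨k, m, γ, hγ, hb⟩, h3⟩
  have hN : N = ∑ r, m r := by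
    have := Fintype.card_of_bijective hb
    simpa using this.symm
  rw [hN]
  exact Finset.even_sum _ fun r _ => (h3 _ _ (hγ r)).1
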